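/- Consider a transmitter broadcasting to $n$ receivers over slotted packet erasure channels. Let $X_{ij}\in\{0,1\}$ indicate whether receiver $i$ receives the packet sent in slot $j\ge 1$. The channels are independent over $i$ and follow a common memory-$l$ Markov law ($l\ge 0$): given the whole past of channel $i$, including its initial state $(X_{i(-l+1)},\dots,X_{i0})$, the probability that $X_{i(m+1)}=1$ is $p(X_{i(m-l+1)},\dots,X_{im})$ for a fixed function $p:\{0,1\}^l\to[0,1]$ (for $l=0$, a constant $p$). Assume that the Markov chain on $\{0,1\}^l$ of the last $l$ channel states is irreducible and aperiodic. The capacity is $\gamma=\lim_{m\to\infty}\mathbb P[X_{im}=1]$, which exists and does not depend on $i$. The packets are sent in consecutive coding blocks of $K\ge 1$ packets. A block that starts after slot $s$ is completed in the first slot $s+m$ such that $\sum_{j=s+1}^{s+m}X_{ij}\ge K$ for all $1\le i\le n$; then the next block starts. Let $R(t)$ be the number of blocks completed in the first $t$ slots, the first block starting in slot $1$. The throughput is $\eta(n,K)=K\lim_{t\to\infty}R(t)/t$; for all $n,K\ge1$ this limit exists almost surely and is a constant. Now let $K=K(n)\ge 1$ be an integer-valued function of $n$. 1. If $p(0,\dots,0)<1$,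 that is, if an erasure has positive probability after $l$ consecutive erasures (for $l=0$: $\gamma<1$), and if $K=o(\log n)$, i.e. $\lim_{n\to\infty}K/\log n=0$, then $\lim_{n\to\infty}\eta(n,K)=0$. 2. If $K=\omega(\log n)$, i.e. $\lim_{n\to\infty}K/\log n=\infty$, then $\lim_{n\to\infty}\eta(n,K)=\gamma$. -/

import Mathlib

open MeasureTheory ProbabilityTheory Filter Topology

noncomputable section

namespace BroadcastErasure

/-- The states of the last `l` slots, oldest first, after the channel state `b` is appended to the
history `s` and the oldest entry is dropped (`true` = received, `false` = erased). -/
def shift {l : ℕ} (s : Fin l → Bool) (b : Bool) : Fin l → Bool :=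
  Fin.tail (Fin.snoc (α := fun _ => Bool) s b)

/-- The transition matrix `Π` on `{0,1}^l` of the chain formed by the last `l` channel states, where
`p s` is the probability of successful reception given that the last `l` states are `s`. -/
def transitionMatrix {l : ℕ} (p : (Fin l → Bool) → ℝ) :
    Matrix (Fin l → Bool) (Fin l → Bool) ℝ :=
  Matrix.of fun s u =>
    (if shift s true = u then p s else 0) + (if shift s false = u then 1 - p s else 0)

/-- Aperiodicity: for every state, the greatest common divisor of the lengths of the possible
returns is `1`. -/
def IsAperiodic {S : Type*} [Fintype S] [DecidableEq S] (P : Matrix S S ℝ) : Prop :=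
  ∀ s : S, ∀ d : ℕ, (∀ k : ℕ, 1 ≤ k → 0 < (P ^ k) s s → d ∣ k) → d = 1

/-- `X i j ω` is the state of the channel to receiver `i`; the slots `j < l` carry the initial
state of the receiver, and transmission takes place in the slots `l, l + 1, l + 2, …`.
The channels of different receivers are independent; given the whole past, each one is in state
`true` in the next slot with probability `p s`, where `s` is the vector of its last `l` states.
The law of the initial states is arbitrary. -/
structure IsMarkovErasureChannel {Ω : Type*} [MeasurableSpace Ω] (μ : Measure Ω) {l : ℕ}
    (p : (Fin l → Bool) → ℝ) (X : ℕ → ℕ → Ω → Bool) : Prop where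
  measurable : ∀ i j, Measurable (X i j)
  indep : iIndepFun (fun (i : ℕ) (ω : Ω) (j : ℕ) => X i j ω) μ
  nonneg : ∀ s, 0 ≤ p s
  le_one : ∀ s, p s ≤ 1
  markov : ∀ (i m : ℕ) (x : ℕ → Bool),
    μ.real {ω | (∀ j < m + l, X i j ω = x j) ∧ X i (m + l) ω = true} =
      p (fun k : Fin l => x (m + k)) * μ.real {ω | ∀ j < m + l, X i j ω = x j}

/-- The number of slots, counted from the first `s` slots on, that a receiver with channel states
`x` needs in order to receive `K` coded packets (`⊤` if it never does). -/
def decodeTime (x : ℕ → Bool) (K s : ℕ) : ℕ∞ :=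
  sInf ((fun m : ℕ => (m : ℕ∞)) '' {m : ℕ | K ≤ ((Finset.range m).filter fun j => x (s + j)).card})

/-- The transmission time of one coding block that starts after the first `s` slots: the maximum of
the decoding times of the receivers `0, …, n - 1`. -/
def transmissionTime (x : ℕ → ℕ → Bool) (n K s : ℕ) : ℕ∞ :=
  ⨆ i : Fin n, decodeTime (x i) K s

/-- The slot in which the `h`-th coding block is completed; each block starts when the preceding
one is completed. -/
def completionTime (x : ℕ → ℕ → Bool) (n K : ℕ) : ℕ → ℕ∞
  | 0 => 0
  | h + 1 => completionTime x n K h + transmissionTime x n K (completionTime x n K h).toNat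

/-- `R(t)`: the number of coding blocks completed within the first `t` slots. -/
def blocksCompleted (x : ℕ → ℕ → Bool) (n K t : ℕ) : ℕ :=
  sSup {h : ℕ | completionTime x n K h ≤ (t : ℕ∞)}

/-- `η` is the throughput with `n` receivers and block size `K`: almost surely, `K R(t) / t`
converges to the constant `η`. -/
def IsThroughput {Ω : Type*} [MeasurableSpace Ω] (μ : Measure Ω) (l : ℕ) (X : ℕ → ℕ → Ω → Bool)
    (n K : ℕ) (η : ℝ) : Prop :=
  ∀ᵐ ω ∂μ, Tendsto
    (fun t : ℕ => (K : ℝ) * ((blocksCompleted (fun i j => X i (l + j) ω) n K t : ℝ) / (t : ℝ)))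
    atTop (𝓝 η)

/-- `γ` is the capacity: for every receiver the probability of successful reception in a slot
converges to `γ`. -/
def IsCapacity {Ω : Type*} [MeasurableSpace Ω] (μ : Measure Ω) (X : ℕ → ℕ → Ω → Bool)
    (γ : ℝ) : Prop :=
  ∀ i : ℕ, Tendsto (fun m : ℕ => μ.real {ω | X i m ω = true}) atTop (𝓝 γ)

end BroadcastErasure

end

/-! Greedy coding is optimal: `h` blocks are completed by slot `t` exactly when `[0, t)` splits into
`h` consecutive intervals, each giving every receiver at least `K` packets
(`completionTime_le_iff`). The resulting block count `blocksIn` is superadditive over adjacent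
intervals, and cutting an interval loses at most one block. Slot counts can therefore be compared
with sums over windows of fixed length, and no renewal or stationarity argument is needed.

Irreducibility and aperiodicity make the transition matrix primitive, so each channel forgets its
history, and by independence so does any finite family of channels. Sums of a bounded window
function then concentrate exponentially, with constants uniform in the channel family and the
starting slot (`exists_concentration`). Applied to the block rate of a window, this gives existence
of the throughput by Borel-Cantelli; applied to one reception, it gives tail bounds for the
receptions of each receiver. By dominated convergence the throughput is also a limit of means
(`tendsto_integral_blocksIn`), so it can be estimated by window probabilities.

For small blocks, `throughput_le` cuts time into windows of length `m`. A window in which some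
receiver is silent contains no whole block, and blocks that straddle boundaries contribute at most
`K / m` to the rate. With `q = 1 - p(0,…,0)`, all `n` receivers escape silence with probability at
most `exp (-n δ q ^ m)`. Taking `m` a small multiple of `log n` makes `n q ^ m` at least `√n`, while
`K / m → 0`.

For large blocks, fix `g < γ` and windows of length about `K / g`. Some receiver gets fewer than `K`
packets with probability at most `n C exp (-κ K)`, which vanishes because `K` dominates `log n`;
hence the rate is nearly `g` (`le_throughput`). No rate exceeds `γ`, since each block costs receiver
`0` at least `K` receptions (`throughput_le_capacity`). -/

noncomputable section

namespace BroadcastErasure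

/-! ### Deterministic block counts and their near additivity. -/

section Combinatorics

/-- The number of slots in `[s, t)` in which the packet is received. -/
def receptions (x : ℕ → Bool) (s t : ℕ) : ℕ := ∑ j ∈ Finset.Ico s t, if x j = true then 1 else 0

lemma receptions_add (x : ℕ → Bool) {s u t : ℕ} (h₁ : s ≤ u) (h₂ : u ≤ t) :
    receptions x s t = receptions x s u + receptions x u t :=
  (Finset.sum_Ico_consecutive _ h₁ h₂).symm

lemma receptions_mono (x : ℕ → Bool) {s s' t t' : ℕ} (h₁ : s' ≤ s) (h₂ : t ≤ t') :
    receptions x s t ≤ receptions x s' t' :=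
  Finset.sum_le_sum_of_subset (Finset.Ico_subset_Ico h₁ h₂)

lemma receptions_le (x : ℕ → Bool) (s t : ℕ) : receptions x s t ≤ t - s := by
  unfold receptions
  rw [← Finset.card_filter]
  exact (Finset.card_filter_le _ _).trans (by simp)

lemma receptions_shift (x : ℕ → Bool) (a s t : ℕ) :
    receptions (fun j => x (a + j)) s t = receptions x (a + s) (a + t) := by
  unfold receptions
  rw [Finset.sum_Ico_add (fun j => if x j = true then 1 else 0) s t a, add_comm s, add_comm t]

lemma receptions_congr {x y : ℕ → Bool} {s t : ℕ} (h : ∀ j, s ≤ j → j < t → x j = y j) :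
    receptions x s t = receptions y s t :=
  Finset.sum_congr rfl fun j hj => by
    rw [Finset.mem_Ico] at hj
    rw [h j hj.1 hj.2]

lemma card_filter_eq_receptions (x : ℕ → Bool) (s m : ℕ) :
    ((Finset.range m).filter fun j => x (s + j)).card = receptions x s (s + m) := by
  rw [receptions, Finset.sum_Ico_eq_sum_range, Finset.card_filter]
  simp

/-- Every receiver receives at least `K` packets in the slots `[s, t)`. -/
def Covers (x : ℕ → ℕ → Bool) (n K s t : ℕ) : Prop := ∀ i < n, K ≤ receptions (x i) s t

lemma Covers.mono {x : ℕ → ℕ → Bool} {n K s s' t t' : ℕ} (h : Covers x n K s t) (h₁ : s' ≤ s)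
    (h₂ : t ≤ t') : Covers x n K s' t' :=
  fun i hi => (h i hi).trans (receptions_mono _ h₁ h₂)

/-- The interval `[s, t)` contains `h` consecutive intervals in each of which every receiver
receives at least `K` packets. -/
def Chain (x : ℕ → ℕ → Bool) (n K : ℕ) : ℕ → ℕ → ℕ → Prop
  | 0, s, t => s ≤ t
  | h + 1, s, t => ∃ u, u ≤ t ∧ Chain x n K h s u ∧ Covers x n K u t

variable {x y : ℕ → ℕ → Bool} {n K : ℕ}

lemma Chain.le : ∀ {h s t : ℕ}, Chain x n K h s t → s ≤ t
  | 0, _, _, hc => hc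
  | _ + 1, _, _, ⟨_, hu, hc, _⟩ => hc.le.trans hu

lemma Chain.mono_right : ∀ {h s t t' : ℕ}, Chain x n K h s t → t ≤ t' → Chain x n K h s t'
  | 0, _, _, _, hc, ht => le_trans (show _ ≤ _ from hc) ht
  | _ + 1, _, _, _, ⟨u, hu, hc, hg⟩, ht => ⟨u, hu.trans ht, hc, hg.mono le_rfl ht⟩

lemma Chain.trans {h : ℕ} : ∀ {h' s t u : ℕ}, Chain x n K h s t → Chain x n K h' t u →
    Chain x n K (h + h') s u
  | 0, _, _, _, hc, hc' => hc.mono_right hc'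
  | _ + 1, _, _, _, hc, ⟨v, hv, hc', hg⟩ => ⟨v, hv, hc.trans hc', hg⟩

/-- Only the one interval of the chain that contains the cut point is lost, hence the `+ 1`. -/
lemma Chain.split : ∀ {h s u t : ℕ}, Chain x n K h s t → s ≤ u → u ≤ t →
    ∃ h₁ h₂, Chain x n K h₁ s u ∧ Chain x n K h₂ u t ∧ h ≤ h₁ + h₂ + 1
  | 0, _, _, _, _, hs, hu => ⟨0, 0, hs, hu, by omega⟩
  | _ + 1, _, u, _, ⟨v, hv, hc, hg⟩, hs, hu => by
    rcases le_total u v with huv | hvu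
    · obtain ⟨h₁, h₂, hc₁, hc₂, hh⟩ := hc.split hs huv
      exact ⟨h₁, h₂ + 1, hc₁, ⟨v, hv, hc₂, hg⟩, by omega⟩
    · exact ⟨_, 0, hc.mono_right hvu, hu, by omega⟩

lemma Chain.mul_le_receptions {i : ℕ} (hi : i < n) : ∀ {h s t : ℕ}, Chain x n K h s t →
    h * K ≤ receptions (x i) s t
  | 0, _, _, _ => by simp
  | _ + 1, _, _, ⟨_, hu, hc, hg⟩ => by
    rw [receptions_add (x i) hc.le hu, add_mul, one_mul]
    exact add_le_add (hc.mul_le_receptions hi) (hg i hi)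

lemma Chain.congr : ∀ {h s t : ℕ}, Chain x n K h s t →
    (∀ i < n, ∀ j, s ≤ j → j < t → x i j = y i j) → Chain y n K h s t
  | 0, _, _, hc, _ => hc
  | _ + 1, _, _, ⟨u, hu, hc, hg⟩, hxy =>
    ⟨u, hu, hc.congr fun i hi j hs hj => hxy i hi j hs (hj.trans_le hu), fun i hi =>
      (hg i hi).trans_eq (receptions_congr fun j hj ht => hxy i hi j (hc.le.trans hj) ht)⟩

lemma Chain.shift_iff {a : ℕ} : ∀ {h s t : ℕ},
    Chain (fun i j => x i (a + j)) n K h s t ↔ Chain x n K h (a + s) (a + t)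
  | 0, s, t => by simp [Chain]
  | h + 1, s, t => by
    constructor
    · rintro ⟨u, hu, hc, hg⟩
      refine ⟨a + u, by omega, Chain.shift_iff.1 hc, fun i hi => ?_⟩
      rw [← receptions_shift]
      exact hg i hi
    · rintro ⟨u, hu, hc, hg⟩
      obtain ⟨u, rfl⟩ : ∃ v, u = a + v := ⟨u - a, by have := hc.le; omega⟩
      refine ⟨u, by omega, Chain.shift_iff.2 hc, fun i hi => ?_⟩
      rw [receptions_shift]
      exact hg i hi

lemma decodeTime_le_iff (z : ℕ → Bool) (K s m : ℕ) :
    decodeTime z K s ≤ (m : ℕ∞) ↔ K ≤ receptions z s (s + m) := by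
  unfold decodeTime
  simp only [card_filter_eq_receptions]
  constructor
  · intro h
    have hne : ((fun m : ℕ => (m : ℕ∞)) '' {m | K ≤ receptions z s (s + m)}).Nonempty := by
      by_contra hne
      rw [Set.not_nonempty_iff_eq_empty] at hne
      rw [hne, sInf_empty] at h
      exact absurd h (by simp)
    obtain ⟨m', hm', he⟩ := csInf_mem hne
    rw [← he] at h
    have h' : m' ≤ m := ENat.natCast_le_natCast.1 h
    exact (show K ≤ _ from hm').trans (receptions_mono z le_rfl (by omega))
  · intro h
    exact sInf_le ⟨m, h, rfl⟩

lemma transmissionTime_le_iff (x : ℕ → ℕ → Bool) (n K s m : ℕ) :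
    transmissionTime x n K s ≤ (m : ℕ∞) ↔ Covers x n K s (s + m) := by
  unfold transmissionTime
  rw [iSup_le_iff]
  simp only [decodeTime_le_iff]
  exact ⟨fun h i hi => h ⟨i, hi⟩, fun h i => h i i.2⟩

/-- Starting a block earlier never delays its completion, so the greedy schedule is at least as fast
as any chain. This replaces the recursive definition by a condition with free cut points. -/
lemma completionTime_le_iff (x : ℕ → ℕ → Bool) (n K : ℕ) : ∀ h t : ℕ,
    completionTime x n K h ≤ (t : ℕ∞) ↔ Chain x n K h 0 t
  | 0, t => by simp [completionTime, Chain]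
  | h + 1, t => by
    have ih := completionTime_le_iff x n K h
    constructor
    · intro hle
      have hle' : completionTime x n K h + transmissionTime x n K (completionTime x n K h).toNat
        ≤ (t : ℕ∞) := hle
      have h1 : completionTime x n K h ≤ (t : ℕ∞) := le_self_add.trans hle'
      obtain ⟨u, hu⟩ := ENat.ne_top_iff_exists.1 (ne_top_of_le_ne_top (ENat.natCast_ne_top t) h1)
      have hut : u ≤ t := by rw [← hu] at h1; exact_mod_cast h1
      refine ⟨u, hut, (ih u).1 hu.symm.le, ?_⟩
      rw [← hu, ENat.toNat_natCast] at hle'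
      obtain ⟨d, rfl⟩ := Nat.exists_eq_add_of_le hut
      rw [← transmissionTime_le_iff]
      push_cast at hle'
      exact (ENat.add_le_add_iff_left (ENat.natCast_ne_top u)).1 hle'
    · rintro ⟨v, hv, hc, hg⟩
      have h1 := (ih v).2 hc
      obtain ⟨u, hu⟩ := ENat.ne_top_iff_exists.1 (ne_top_of_le_ne_top (ENat.natCast_ne_top v) h1)
      have huv : u ≤ v := by rw [← hu] at h1; exact_mod_cast h1
      obtain ⟨d, rfl⟩ := Nat.exists_eq_add_of_le (huv.trans hv)
      have h2 := (transmissionTime_le_iff x n K u d).2 (hg.mono huv le_rfl)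
      change completionTime x n K h + transmissionTime x n K (completionTime x n K h).toNat ≤ _
      rw [← hu, ENat.toNat_natCast]
      push_cast
      gcongr

/-- The number of blocks completed in the slots `[s, t)` if a new block starts in slot `s`. -/
def blocksIn (x : ℕ → ℕ → Bool) (n K s t : ℕ) : ℕ := sSup {h : ℕ | Chain x n K h s t}

lemma blocksCompleted_eq (x : ℕ → ℕ → Bool) (n K t : ℕ) :
    blocksCompleted x n K t = blocksIn x n K 0 t := by
  unfold blocksCompleted blocksIn
  simp only [completionTime_le_iff]

lemma blocksIn_shift (x : ℕ → ℕ → Bool) (n K a s t : ℕ) :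
    blocksIn (fun i j => x i (a + j)) n K s t = blocksIn x n K (a + s) (a + t) := by
  unfold blocksIn
  simp only [Chain.shift_iff]

lemma blocksIn_congr {s t : ℕ} (h : ∀ i < n, ∀ j, s ≤ j → j < t → x i j = y i j) :
    blocksIn x n K s t = blocksIn y n K s t := by
  unfold blocksIn
  congr 1
  ext k
  exact ⟨fun hc => hc.congr h, fun hc => hc.congr fun i hi j hs ht => (h i hi j hs ht).symm⟩

lemma Chain.le_sub (hn : 1 ≤ n) (hK : 1 ≤ K) {h s t : ℕ} (hc : Chain x n K h s t) :
    h ≤ t - s :=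
  (Nat.le_mul_of_pos_right h hK).trans
    ((hc.mul_le_receptions (i := 0) hn).trans (receptions_le _ _ _))

lemma Chain.le_blocksIn (hn : 1 ≤ n) (hK : 1 ≤ K) {h s t : ℕ} (hc : Chain x n K h s t) :
    h ≤ blocksIn x n K s t :=
  le_csSup ⟨t - s, fun _ hk => Chain.le_sub hn hK hk⟩ hc

lemma chain_blocksIn (hn : 1 ≤ n) (hK : 1 ≤ K) {s t : ℕ} (hst : s ≤ t) :
    Chain x n K (blocksIn x n K s t) s t :=
  Nat.sSup_mem (s := {h : ℕ | Chain x n K h s t}) ⟨0, hst⟩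
    ⟨t - s, fun _ hk => Chain.le_sub hn hK hk⟩

lemma blocksIn_mul_le_receptions (hn : 1 ≤ n) (hK : 1 ≤ K) {i : ℕ} (hi : i < n) {s t : ℕ}
    (hst : s ≤ t) : blocksIn x n K s t * K ≤ receptions (x i) s t :=
  (chain_blocksIn hn hK hst).mul_le_receptions hi

lemma blocksIn_le (hn : 1 ≤ n) (hK : 1 ≤ K) {s t : ℕ} (hst : s ≤ t) :
    blocksIn x n K s t ≤ t - s :=
  (chain_blocksIn hn hK hst).le_sub hn hK

lemma blocksIn_add_le (hn : 1 ≤ n) (hK : 1 ≤ K) {s u t : ℕ} (h₁ : s ≤ u) (h₂ : u ≤ t) :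
    blocksIn x n K s u + blocksIn x n K u t ≤ blocksIn x n K s t :=
  ((chain_blocksIn hn hK h₁).trans (chain_blocksIn hn hK h₂)).le_blocksIn hn hK

lemma blocksIn_le_add (hn : 1 ≤ n) (hK : 1 ≤ K) {s u t : ℕ} (h₁ : s ≤ u) (h₂ : u ≤ t) :
    blocksIn x n K s t ≤ blocksIn x n K s u + blocksIn x n K u t + 1 := by
  obtain ⟨a, b, ha, hb, hab⟩ := (chain_blocksIn (x := x) hn hK (h₁.trans h₂)).split h₁ h₂
  have := ha.le_blocksIn hn hK
  have := hb.le_blocksIn hn hK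
  omega

lemma blocksIn_mono (hn : 1 ≤ n) (hK : 1 ≤ K) {s t t' : ℕ} (h₁ : s ≤ t) (h₂ : t ≤ t') :
    blocksIn x n K s t ≤ blocksIn x n K s t' :=
  le_self_add.trans (blocksIn_add_le hn hK h₁ h₂)

lemma one_le_blocksIn (hn : 1 ≤ n) (hK : 1 ≤ K) {s t : ℕ} (hst : s ≤ t)
    (hg : Covers x n K s t) : 1 ≤ blocksIn x n K s t :=
  Chain.le_blocksIn (h := 1) hn hK ⟨s, hst, le_rfl, hg⟩

lemma sum_blocksIn_le (hn : 1 ≤ n) (hK : 1 ≤ K) (a W N : ℕ) :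
    ∑ k ∈ Finset.range N, blocksIn x n K (a + W * k) (a + W * k + W) ≤
      blocksIn x n K a (a + W * N) := by
  induction N with
  | zero => simp
  | succ N ih =>
    rw [Finset.sum_range_succ]
    refine (add_le_add_left ih _).trans ?_
    have := blocksIn_add_le (x := x) hn hK (s := a) (u := a + W * N) (t := a + W * (N + 1))
      (by omega) (by rw [mul_add]; omega)
    rwa [show a + W * (N + 1) = a + W * N + W by ring] at this ⊢

lemma blocksIn_le_sum (hn : 1 ≤ n) (hK : 1 ≤ K) (a W N : ℕ) :
    blocksIn x n K a (a + W * N) ≤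
      ∑ k ∈ Finset.range N, (blocksIn x n K (a + W * k) (a + W * k + W) + 1) := by
  induction N with
  | zero => simpa using blocksIn_le (x := x) hn hK (le_refl a)
  | succ N ih =>
    rw [Finset.sum_range_succ]
    have := blocksIn_le_add (x := x) hn hK (s := a) (u := a + W * N) (t := a + W * (N + 1))
      (by omega) (by rw [mul_add]; omega)
    rw [show a + W * (N + 1) = a + W * N + W by ring] at this ⊢
    omega

end Combinatorics

section Chains

/-! ### Primitive stochastic matrices and their convergence. -/

section Matrix

variable {S : Type*} [Fintype S] {P : Matrix S S ℝ}

/-- A matrix with nonnegative entries and row sums `1`. -/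
def IsStochastic (P : Matrix S S ℝ) : Prop := (∀ i j, 0 ≤ P i j) ∧ ∀ i, ∑ j, P i j = 1

lemma IsStochastic.le_mulVec (hP : IsStochastic P) {φ : S → ℝ} {a : ℝ} (h : ∀ s, a ≤ φ s)
    (s : S) : a ≤ P.mulVec φ s := by
  calc a = ∑ u, P s u * a := by rw [← Finset.sum_mul, hP.2, one_mul]
    _ ≤ ∑ u, P s u * φ u := Finset.sum_le_sum fun u _ => mul_le_mul_of_nonneg_left (h u) (hP.1 s u)

lemma IsStochastic.mulVec_le (hP : IsStochastic P) {φ : S → ℝ} {a : ℝ} (h : ∀ s, φ s ≤ a)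
    (s : S) : P.mulVec φ s ≤ a := by
  calc ∑ u, P s u * φ u ≤ ∑ u, P s u * a :=
        Finset.sum_le_sum fun u _ => mul_le_mul_of_nonneg_left (h u) (hP.1 s u)
    _ = a := by rw [← Finset.sum_mul, hP.2, one_mul]

/-- Every row puts mass at least `δ` on `u`, which pulls its average down from `a` towards `b`. With
`a` the maximum and `b` the minimum of `φ`, this is the contraction of the oscillation. -/
lemma IsStochastic.mulVec_le_sub (hP : IsStochastic P) {φ : S → ℝ} {a b δ : ℝ}
    (h : ∀ s, φ s ≤ a) {u : S} (hu : φ u = b) (hδ : ∀ s, δ ≤ P s u)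
    (s : S) : P.mulVec φ s ≤ a - δ * (a - b) := by
  have h1 : P s u * (a - φ u) ≤ ∑ v, P s v * (a - φ v) :=
    Finset.single_le_sum (f := fun v => P s v * (a - φ v))
      (fun v _ => mul_nonneg (hP.1 s v) (sub_nonneg.2 (h v))) (Finset.mem_univ u)
  simp only [mul_sub, Finset.sum_sub_distrib, ← Finset.sum_mul, hP.2, one_mul] at h1
  have h2 : δ * (a - b) ≤ P s u * (a - b) :=
    mul_le_mul_of_nonneg_right (hδ s) (sub_nonneg.2 (hu ▸ h u))
  have h3 : P.mulVec φ s = ∑ v, P s v * φ v := rfl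
  rw [hu] at h1
  rw [h3]
  linarith

variable [DecidableEq S]

lemma IsStochastic.pow (hP : IsStochastic P) : ∀ k : ℕ, IsStochastic (P ^ k)
  | 0 => ⟨Matrix.pow_apply_nonneg hP.1 0, fun i => by simp [Matrix.one_apply]⟩
  | k + 1 => ⟨Matrix.pow_apply_nonneg hP.1 (k + 1), fun i => by
      simp only [pow_succ, Matrix.mul_apply]
      rw [Finset.sum_comm]
      simp only [← Finset.mul_sum, hP.2, mul_one, (hP.pow k).2]⟩

lemma pow_pos_add (hP : ∀ i j, 0 ≤ P i j) {a b : ℕ} {s u v : S} (h₁ : 0 < (P ^ a) s u)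
    (h₂ : 0 < (P ^ b) u v) : 0 < (P ^ (a + b)) s v := by
  rw [pow_add, Matrix.mul_apply]
  exact Finset.sum_pos' (fun w _ => mul_nonneg (Matrix.pow_apply_nonneg hP a s w)
    (Matrix.pow_apply_nonneg hP b w v)) ⟨u, Finset.mem_univ u, mul_pos h₁ h₂⟩

/-- An irreducible aperiodic matrix is primitive. -/
theorem isPrimitive_of_isAperiodic (hirr : P.IsIrreducible) (haper : IsAperiodic P) :
    P.IsPrimitive := by
  have hP := hirr.nonneg
  have hret : ∀ s : S, ∃ N : ℕ, ∀ m ≥ N, 0 < (P ^ m) s s := by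
    intro s
    -- The additive semigroup generated by the return times contains all large multiples of their
    -- gcd, which is `1`.
    obtain ⟨N, hN⟩ := Nat.exists_mem_closure_of_ge {k : ℕ | 1 ≤ k ∧ 0 < (P ^ k) s s}
    have hg : Nat.setGcd {k : ℕ | 1 ≤ k ∧ 0 < (P ^ k) s s} = 1 :=
      haper s _ fun k hk hpos => Nat.setGcd_dvd_of_mem ⟨hk, hpos⟩
    refine ⟨N, fun m hm => ?_⟩
    have hmem := hN m hm (by rw [hg]; exact one_dvd m)
    clear hm
    induction hmem using AddSubmonoid.closure_induction with
    | mem k hk => exact hk.2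
    | zero => simp
    | add a b _ _ ha hb => exact pow_pos_add hP ha hb
  choose N hN using hret
  choose k _ hk using (Matrix.isIrreducible_iff_exists_pow_pos hP).1 hirr
  -- One exponent serves all pairs: the surplus over `k s u` is spent on returns to `s`.
  refine ⟨hP, (∑ s, ∑ u, (N s + k s u)) + 1, Nat.succ_pos _, fun s u => ?_⟩
  have h1 : N s + k s u ≤ ∑ s, ∑ u, (N s + k s u) :=
    (Finset.single_le_sum (f := fun u => N s + k s u) (fun _ _ => Nat.zero_le _)
      (Finset.mem_univ u)).trans
      (Finset.single_le_sum (f := fun s => ∑ u, (N s + k s u)) (fun _ _ => Nat.zero_le _)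
        (Finset.mem_univ s))
  obtain ⟨d, hd⟩ := Nat.exists_eq_add_of_le h1
  rw [hd, show N s + k s u + d + 1 = (N s + d + 1) + k s u by ring]
  exact pow_pos_add hP (hN s _ (by omega)) (hk s u)

/-- The entries of `P ^ (d + N)` are averages of entries of `P ^ N` in the same column, so a lower
bound at `N` persists for all later exponents. -/
lemma IsStochastic.exists_le_pow (hP : IsStochastic P) (hprim : P.IsPrimitive) :
    ∃ δ > 0, ∃ N : ℕ, 0 < N ∧ ∀ G ≥ N, ∀ s u, δ ≤ (P ^ G) s u := by
  obtain ⟨N, hN, hpos⟩ := hprim.exists_pos_pow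
  rcases isEmpty_or_nonempty S with hS | hS
  · exact ⟨1, one_pos, N, hN, fun _ _ s => (hS.false s).elim⟩
  obtain ⟨su, hsu⟩ := Finite.exists_min fun su : S × S => (P ^ N) su.1 su.2
  refine ⟨_, hpos su.1 su.2, N, hN, fun G hG s u => ?_⟩
  obtain ⟨d, rfl⟩ := Nat.exists_eq_add_of_le' hG
  rw [pow_add, Matrix.mul_apply]
  exact (hP.pow d).le_mulVec (φ := fun v => (P ^ N) v u) (fun v => hsu (v, u)) s

/-- For a primitive stochastic matrix `P`, the vectors `P ^ k φ` converge to a constant vector. -/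
theorem IsStochastic.exists_tendsto_pow_mulVec (hP : IsStochastic P) (hprim : P.IsPrimitive)
    (φ : S → ℝ) : ∃ c, ∀ s, Tendsto (fun k : ℕ => (P ^ k).mulVec φ s) atTop (𝓝 c) := by
  rcases isEmpty_or_nonempty S with hS | hS
  · exact ⟨0, fun s => (hS.false s).elim⟩
  obtain ⟨δ, hδ, N, hN, hle⟩ := hP.exists_le_pow hprim
  have hδ1 : δ ≤ 1 := by
    obtain ⟨s⟩ := hS
    refine (hle N le_rfl s s).trans ?_
    rw [← (hP.pow N).2 s]
    exact Finset.single_le_sum (f := fun u => (P ^ N) s u) (fun u _ => (hP.pow N).1 s u)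
      (Finset.mem_univ s)
  have hub : ∀ (ψ : S → ℝ) s, ψ s ≤ ⨆ s, ψ s := fun ψ s =>
    le_ciSup (Set.finite_range ψ).bddAbove s
  have hlb : ∀ (ψ : S → ℝ) s, ⨅ s, ψ s ≤ ψ s := fun ψ s =>
    ciInf_le (Set.finite_range ψ).bddBelow s
  set v : ℕ → S → ℝ := fun k => (P ^ k).mulVec φ with hv
  have hvadd : ∀ a b, v (a + b) = (P ^ a).mulVec (v b) := fun a b => by
    simp only [hv, Matrix.mulVec_mulVec, pow_add]
  set hi : ℕ → ℝ := fun k => ⨆ s, v k s with hhi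
  set lo : ℕ → ℝ := fun k => ⨅ s, v k s with hlo
  have hlohi : ∀ k, lo k ≤ hi k := fun k => by
    obtain ⟨s⟩ := hS
    exact (hlb _ s).trans (hub _ s)
  have hhimono : ∀ a b, hi (a + b) ≤ hi b := fun a b =>
    ciSup_le fun s => by
      rw [hvadd]
      exact (hP.pow a).mulVec_le (hub (v b)) s
  have hlomono : ∀ a b, lo b ≤ lo (a + b) := fun a b =>
    le_ciInf fun s => by
      rw [hvadd]
      exact (hP.pow a).le_mulVec (hlb (v b)) s
  have hcontr : ∀ b, hi (N + b) - lo (N + b) ≤ (1 - δ) * (hi b - lo b) := fun b => by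
    obtain ⟨u, hu⟩ := exists_eq_ciInf_of_finite (f := v b)
    have h1 : hi (N + b) ≤ hi b - δ * (hi b - lo b) := ciSup_le fun s => by
      rw [hvadd]
      exact (hP.pow N).mulVec_le_sub (hub (v b)) hu (fun s => hle N le_rfl s u) s
    have h2 := hlomono N b
    linarith
  have hhianti : Antitone hi := fun a b hab => by
    obtain ⟨d, rfl⟩ := Nat.exists_eq_add_of_le' hab
    exact hhimono d a
  have hgapanti : Antitone fun k => hi k - lo k := fun a b hab => by
    obtain ⟨d, rfl⟩ := Nat.exists_eq_add_of_le' hab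
    exact sub_le_sub (hhimono d a) (hlomono d a)
  have hpow : ∀ k, hi (N * k) - lo (N * k) ≤ (1 - δ) ^ k * (hi 0 - lo 0) := by
    intro k
    induction k with
    | zero => simp
    | succ k ih =>
      rw [show N * (k + 1) = N + N * k by ring, pow_succ', mul_assoc]
      exact (hcontr _).trans (mul_le_mul_of_nonneg_left ih (by linarith))
  have hlim0 : Tendsto (fun k => hi (N * k) - lo (N * k)) atTop (𝓝 0) := by
    refine squeeze_zero (fun k => sub_nonneg.2 (hlohi _)) hpow ?_
    simpa using (tendsto_pow_atTop_nhds_zero_of_lt_one (r := 1 - δ) (by linarith)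
      (by linarith)).mul_const (hi 0 - lo 0)
  -- The oscillation is monotone, so its limit along multiples of `N` is its limit.
  have hgap : Tendsto (fun k => hi k - lo k) atTop (𝓝 0) := by
    have h1 := tendsto_atTop_ciInf hgapanti ⟨0, by
      rintro _ ⟨k, rfl⟩
      exact sub_nonneg.2 (hlohi k)⟩
    have h2 := h1.comp (tendsto_id.const_mul_atTop' hN)
    rwa [tendsto_nhds_unique h2 hlim0] at h1
  have hhilim := tendsto_atTop_ciInf hhianti ⟨lo 0, by
    rintro _ ⟨k, rfl⟩
    exact (hlomono k 0).trans (hlohi _)⟩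
  refine ⟨⨅ k, hi k, fun s => ?_⟩
  have hlolim : Tendsto lo atTop (𝓝 (⨅ k, hi k)) := by
    simpa using hhilim.sub hgap
  exact tendsto_of_tendsto_of_tendsto_of_le_of_le hlolim hhilim (fun k => hlb (v k) s)
    fun k => hub (v k) s

end Matrix

/-! ### Path probabilities of a single channel. -/

section Transition

variable {l : ℕ} {p : (Fin l → Bool) → ℝ}

/-- The probability of the channel state `b` after the history `s`. -/
def weight (p : (Fin l → Bool) → ℝ) (s : Fin l → Bool) (b : Bool) : ℝ :=
  if b = true then p s else 1 - p s

lemma transitionMatrix_mulVec (p φ : (Fin l → Bool) → ℝ) (s : Fin l → Bool) :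
    (transitionMatrix p).mulVec φ s =
      weight p s true * φ (shift s true) + weight p s false * φ (shift s false) := by
  simp [Matrix.mulVec, dotProduct, transitionMatrix, weight, add_mul, Finset.sum_add_distrib]

lemma isStochastic_transitionMatrix (h₀ : ∀ s, 0 ≤ p s) (h₁ : ∀ s, p s ≤ 1) :
    IsStochastic (transitionMatrix p) := by
  refine ⟨fun s u => ?_, fun s => ?_⟩
  · have := h₀ s
    have := h₁ s
    simp only [transitionMatrix, Matrix.of_apply]
    split_ifs <;> linarith
  · simp [transitionMatrix, Finset.sum_add_distrib]

/-- The probability that the channel states `w 0, …, w (W - 1)` follow the history `s`. -/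
def pathProb (p : (Fin l → Bool) → ℝ) : ℕ → (Fin l → Bool) → (ℕ → Bool) → ℝ
  | 0, _, _ => 1
  | W + 1, s, w => weight p s (w 0) * pathProb p W (shift s (w 0)) fun j => w (j + 1)

/-- The probability that the channel states `w 0, …, w (W - 1)` occur `G` slots after the
history `s`. -/
def gapProb (p : (Fin l → Bool) → ℝ) (G W : ℕ) (s : Fin l → Bool) (w : ℕ → Bool) : ℝ :=
  (transitionMatrix p ^ G).mulVec (fun u => pathProb p W u w) s

lemma gapProb_zero (p : (Fin l → Bool) → ℝ) (W : ℕ) (s : Fin l → Bool) (w : ℕ → Bool) :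
    gapProb p 0 W s w = pathProb p W s w := by
  simp [gapProb]

lemma gapProb_succ (p : (Fin l → Bool) → ℝ) (G W : ℕ) (s : Fin l → Bool) (w : ℕ → Bool) :
    gapProb p (G + 1) W s w =
      weight p s true * gapProb p G W (shift s true) w +
        weight p s false * gapProb p G W (shift s false) w := by
  unfold gapProb
  rw [pow_succ', ← Matrix.mulVec_mulVec, transitionMatrix_mulVec]

lemma shift_false (l : ℕ) : shift (fun _ : Fin l => false) false = fun _ => false := by
  funext k
  simp only [shift, Fin.tail, Fin.snoc]
  split_ifs <;> simp

/-- The all-erased history is fixed by a further erasure, so each slot contributes the same factor.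
-/
lemma pathProb_erasures (p : (Fin l → Bool) → ℝ) (W : ℕ) :
    pathProb p W (fun _ => false) (fun _ => false) = (1 - p fun _ => false) ^ W := by
  induction W with
  | zero => rfl
  | succ W ih =>
    rw [pathProb, shift_false, ih, pow_succ']
    simp [weight]

lemma pathProb_nonneg (h₀ : ∀ s, 0 ≤ p s) (h₁ : ∀ s, p s ≤ 1) :
    ∀ (W : ℕ) (s : Fin l → Bool) (w : ℕ → Bool), 0 ≤ pathProb p W s w
  | 0, _, _ => zero_le_one
  | W + 1, s, w => mul_nonneg (by
      have := h₀ s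
      have := h₁ s
      unfold weight
      split_ifs <;> linarith) (pathProb_nonneg h₀ h₁ W _ _)

end Transition

end Chains

/-! ### Joint law of past and future window for finitely many receivers. -/

section JointLaw

/-- The history of length `l` after the slots `0, …, m + l - 1` of the sequence `x`. -/
def history (l m : ℕ) (x : ℕ → Bool) : Fin l → Bool := fun k => x (m + k)

lemma history_update (l m : ℕ) (x : ℕ → Bool) (b : Bool) :
    history l (m + 1) (Function.update x (m + l) b) = shift (history l m x) b := by
  funext k
  simp only [history, shift, Fin.tail, Fin.snoc, Function.update_apply]
  have := k.2
  by_cases h : (k : ℕ) + 1 < l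
  · rw [if_neg (by omega)]
    simp [h, Nat.add_left_comm, Nat.add_comm]
  · rw [if_pos (by omega)]
    simp [h]

lemma forall_lt_update_iff (y x : ℕ → Bool) (m : ℕ) (b : Bool) :
    (∀ j < m + 1, y j = Function.update x m b j) ↔ (∀ j < m, y j = x j) ∧ y m = b := by
  constructor
  · intro h
    refine ⟨fun j hj => ?_, ?_⟩
    · rw [h j (by omega), Function.update_of_ne (by omega)]
    · rw [h m (by omega), Function.update_self]
  · rintro ⟨h₁, h₂⟩ j hj
    rcases Nat.lt_succ_iff_lt_or_eq.1 hj with hj | rfl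
    · rw [h₁ j hj, Function.update_of_ne (by omega)]
    · rw [h₂, Function.update_self]

/-- The sequences that agree with `x` in the slots before `m` and with `w` in the `W` slots from
slot `m'` on. -/
def pathSet (x w : ℕ → Bool) (m m' W : ℕ) : Set (ℕ → Bool) :=
  {y | (∀ j < m, y j = x j) ∧ ∀ j < W, y (m' + j) = w j}

lemma measurableSet_pathSet (x w : ℕ → Bool) (m m' W : ℕ) :
    MeasurableSet (pathSet x w m m' W) := by
  unfold pathSet
  measurability

/-- Restriction of finitely many sequences to finitely many slots. -/
def restrict (n M : ℕ) (x : ℕ → ℕ → Bool) : Fin n → Fin M → Bool := fun i j => x i j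

/-- Extension by `false`. -/
def extend {n M : ℕ} (z : Fin n → Fin M → Bool) : ℕ → ℕ → Bool :=
  fun i j => if h : i < n ∧ j < M then z ⟨i, h.1⟩ ⟨j, h.2⟩ else false

lemma extend_apply {n M : ℕ} (z : Fin n → Fin M → Bool) (i : Fin n) {j : ℕ} (hj : j < M) :
    extend z i j = z i ⟨j, hj⟩ := by
  simp [extend, hj]

/-- `H x` depends only on the first `M` slots of the first `n` receivers. -/
def DependsOnFirst {α : Type*} (n M : ℕ) (H : (ℕ → ℕ → Bool) → α) : Prop :=
  ∀ x y, (∀ i < n, ∀ j < M, x i j = y i j) → H x = H y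

/-- Such an `H` factors through a finite type, which makes it measurable and turns its mean into a
finite sum. -/
lemma DependsOnFirst.extend_restrict {α : Type*} {n M : ℕ} {H : (ℕ → ℕ → Bool) → α}
    (hH : DependsOnFirst n M H) (x : ℕ → ℕ → Bool) : H (extend (restrict n M x)) = H x :=
  hH _ _ fun i hi j hj => by
    rw [extend_apply (restrict n M x) ⟨i, hi⟩ hj, restrict]

/-- The mean of `F` for `n` independent channels with histories `s`, `G` slots later. -/
def gapMean {l : ℕ} (p : (Fin l → Bool) → ℝ) (n W G : ℕ) (F : (ℕ → ℕ → Bool) → ℝ)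
    (s : Fin n → Fin l → Bool) : ℝ :=
  ∑ w : Fin n → Fin W → Bool, F (extend w) * ∏ i : Fin n, gapProb p G W (s i) (extend w i)

variable {Ω : Type*} [MeasurableSpace Ω] {μ : Measure Ω}
  {l : ℕ} {p : (Fin l → Bool) → ℝ} {X : ℕ → ℕ → Ω → Bool}

namespace IsMarkovErasureChannel

lemma comp_injective (hX : IsMarkovErasureChannel μ p X) {e : ℕ → ℕ} (he : e.Injective) :
    IsMarkovErasureChannel μ p fun i => X (e i) where
  measurable i := hX.measurable (e i)
  indep := hX.indep.precomp he
  nonneg := hX.nonneg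
  le_one := hX.le_one
  markov i := hX.markov (e i)

/-- Moves receiver `i` to position `0`, so that statements about the first receiver apply to every
receiver. -/
lemma comp_add_left (hX : IsMarkovErasureChannel μ p X) (i : ℕ) :
    IsMarkovErasureChannel μ p fun k => X (i + k) :=
  hX.comp_injective (add_right_injective i)

lemma measurable_channel (hX : IsMarkovErasureChannel μ p X) (i : ℕ) :
    Measurable fun ω j => X i j ω :=
  measurable_pi_lambda _ fun j => hX.measurable i j

lemma measurable_restrict (hX : IsMarkovErasureChannel μ p X) (n M a : ℕ) :
    Measurable fun ω => restrict n M fun i j => X i (a + j) ω :=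
  measurable_pi_lambda _ fun i => measurable_pi_lambda _ fun j => hX.measurable i (a + j)

lemma measurable_of_dependsOnFirst (hX : IsMarkovErasureChannel μ p X) {α : Type*}
    [MeasurableSpace α] {n M : ℕ} {H : (ℕ → ℕ → Bool) → α} (hH : DependsOnFirst n M H) (a : ℕ) :
    Measurable fun ω => H fun i j => X i (a + j) ω := by
  have h : (fun ω => H fun i j => X i (a + j) ω) =
      (fun z => H (extend z)) ∘ fun ω => restrict n M fun i j => X i (a + j) ω := by
    funext ω
    exact (hH.extend_restrict _).symm
  rw [h]
  exact (measurable_of_finite _).comp (hX.measurable_restrict n M a)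

variable [IsProbabilityMeasure μ]

lemma measureReal_next (hX : IsMarkovErasureChannel μ p X) (i m : ℕ) (x : ℕ → Bool) (b : Bool) :
    μ.real {ω | (∀ j < m + l, X i j ω = x j) ∧ X i (m + l) ω = b} =
      weight p (history l m x) b * μ.real {ω | ∀ j < m + l, X i j ω = x j} := by
  have htrue : μ.real {ω | (∀ j < m + l, X i j ω = x j) ∧ X i (m + l) ω = true} =
    p (history l m x) * μ.real {ω | ∀ j < m + l, X i j ω = x j} := hX.markov i m x
  cases b with
  | true => simpa [weight] using htrue
  | false =>
    have hmeas : MeasurableSet {ω | X i (m + l) ω = true} :=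
      hX.measurable i (m + l) (measurableSet_singleton true)
    have h := measureReal_inter_add_sdiff (μ := μ) (s := {ω | ∀ j < m + l, X i j ω = x j}) hmeas
    have h1 : {ω | ∀ j < m + l, X i j ω = x j} ∩ {ω | X i (m + l) ω = true} =
      {ω | (∀ j < m + l, X i j ω = x j) ∧ X i (m + l) ω = true} := rfl
    have h2 : {ω | ∀ j < m + l, X i j ω = x j} \ {ω | X i (m + l) ω = true} =
      {ω | (∀ j < m + l, X i j ω = x j) ∧ X i (m + l) ω = false} := by
      ext ω
      simp
    rw [h1, h2, htrue] at h
    simp only [weight, Bool.false_eq_true, if_false]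
    linarith

lemma measureReal_path_zero (hX : IsMarkovErasureChannel μ p X) (i W : ℕ) :
    ∀ (m : ℕ) (x w : ℕ → Bool),
    μ.real {ω | (∀ j < m + l, X i j ω = x j) ∧ ∀ j < W, X i (m + l + j) ω = w j} =
      μ.real {ω | ∀ j < m + l, X i j ω = x j} * pathProb p W (history l m x) w := by
  induction W with
  | zero => simp [pathProb]
  | succ W ih =>
    intro m x w
    -- The first slot of the window is absorbed into the past by overwriting `x` there.
    have h := ih (m + 1) (Function.update x (m + l) (w 0)) fun j => w (j + 1)
    simp only [show m + 1 + l = m + l + 1 by ring, forall_lt_update_iff] at h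
    rw [history_update, hX.measureReal_next i m x (w 0)] at h
    rw [pathProb, show μ.real {ω | ∀ j < m + l, X i j ω = x j} *
      (weight p (history l m x) (w 0) * pathProb p W (shift (history l m x) (w 0))
        fun j => w (j + 1)) = weight p (history l m x) (w 0) *
        μ.real {ω | ∀ j < m + l, X i j ω = x j} *
        pathProb p W (shift (history l m x) (w 0)) (fun j => w (j + 1)) by ring, ← h]
    congr 1
    ext ω
    simp only [Set.mem_ofPred_eq, and_assoc]
    refine and_congr_right fun _ => ⟨fun h => ⟨h 0 (by omega), fun j hj => ?_⟩, fun h j hj => ?_⟩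
    · rw [← h (j + 1) (by omega)]
      congr 1
      ring
    · cases j with
      | zero => exact h.1
      | succ j =>
        rw [← h.2 j (by omega)]
        congr 1
        ring

/-- The probability that a past is followed, after a gap of `G` slots, by given channel states. -/
lemma measureReal_path (hX : IsMarkovErasureChannel μ p X) (i W G : ℕ) :
    ∀ (m : ℕ) (x w : ℕ → Bool),
    μ.real {ω | (∀ j < m + l, X i j ω = x j) ∧ ∀ j < W, X i (m + l + G + j) ω = w j} =
      μ.real {ω | ∀ j < m + l, X i j ω = x j} * gapProb p G W (history l m x) w := by
  induction G with
  | zero =>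
    intro m x w
    rw [gapProb_zero]
    exact hX.measureReal_path_zero i W m x w
  | succ G ih =>
    intro m x w
    -- The first slot of the gap is unconstrained; the event is split according to its value `b`.
    have h := fun b => ih (m + 1) (Function.update x (m + l) b) w
    simp only [show m + 1 + l = m + l + 1 by ring, forall_lt_update_iff, history_update,
      hX.measureReal_next i m x] at h
    have hmeas : MeasurableSet {ω | X i (m + l) ω = true} :=
      hX.measurable i (m + l) (measurableSet_singleton true)
    have hsplit := measureReal_inter_add_sdiff (μ := μ)
      (s := {ω | (∀ j < m + l, X i j ω = x j) ∧
        ∀ j < W, X i (m + l + (G + 1) + j) ω = w j}) hmeas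
    rw [← hsplit, gapProb_succ, mul_add]
    have e1 := h true
    have e2 := h false
    rw [show μ.real {ω | ∀ j < m + l, X i j ω = x j} * (weight p (history l m x) true *
      gapProb p G W (shift (history l m x) true) w) = weight p (history l m x) true *
      μ.real {ω | ∀ j < m + l, X i j ω = x j} *
      gapProb p G W (shift (history l m x) true) w by ring, ← e1,
      show μ.real {ω | ∀ j < m + l, X i j ω = x j} * (weight p (history l m x) false *
      gapProb p G W (shift (history l m x) false) w) = weight p (history l m x) false *
      μ.real {ω | ∀ j < m + l, X i j ω = x j} *
      gapProb p G W (shift (history l m x) false) w by ring, ← e2]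
    congr 2
    · ext ω
      simp only [Set.mem_ofPred_eq, Set.mem_inter_iff, show m + l + (G + 1) = m + l + 1 + G by ring]
      tauto
    · ext ω
      simp only [Set.mem_ofPred_eq, Set.mem_sdiff, show m + l + (G + 1) = m + l + 1 + G by ring,
        Bool.not_eq_true]
      tauto

/-- The joint version of `measureReal_path` for the first `n` receivers. -/
lemma measureReal_joint (hX : IsMarkovErasureChannel μ p X) (n W G m : ℕ) (x w : ℕ → ℕ → Bool) :
    μ.real {ω | ∀ i : Fin n, (∀ j < m + l, X i j ω = x i j) ∧
        ∀ j < W, X i (m + l + G + j) ω = w i j} =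
      (∏ i : Fin n, μ.real {ω | ∀ j < m + l, X i j ω = x i j}) *
        ∏ i : Fin n, gapProb p G W (history l m (x i)) (w i) := by
  have hind := (hX.indep.precomp (g := fun i : Fin n => (i : ℕ)) Fin.val_injective)
  have h := hind.measure_inter_preimage_eq_mul Finset.univ
    (sets := fun i => pathSet (x i) (w i) (m + l) (m + l + G) W)
    fun i _ => measurableSet_pathSet _ _ _ _ _
  rw [← Finset.prod_mul_distrib]
  have hset : {ω | ∀ i : Fin n, (∀ j < m + l, X i j ω = x i j) ∧
      ∀ j < W, X i (m + l + G + j) ω = w i j} = ⋂ i ∈ (Finset.univ : Finset (Fin n)),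
      (fun ω j => X i j ω) ⁻¹' pathSet (x i) (w i) (m + l) (m + l + G) W := by
    ext ω
    simp [pathSet]
  rw [hset, measureReal_def]
  refine (congrArg ENNReal.toReal h).trans ?_
  rw [ENNReal.toReal_prod]
  refine Finset.prod_congr rfl fun i _ => ?_
  rw [← hX.measureReal_path]
  rfl

lemma measureReal_past (hX : IsMarkovErasureChannel μ p X) (n m : ℕ) (x : ℕ → ℕ → Bool) :
    μ.real {ω | ∀ i : Fin n, ∀ j < m + l, X i j ω = x i j} =
      ∏ i : Fin n, μ.real {ω | ∀ j < m + l, X i j ω = x i j} := by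
  simpa [gapProb_zero, pathProb] using hX.measureReal_joint n 0 0 m x x

lemma restrict_eq_iff {n M : ℕ} (x : ℕ → ℕ → Bool) (z : Fin n → Fin M → Bool) :
    restrict n M x = z ↔ ∀ i : Fin n, ∀ j < M, x i j = extend z i j := by
  constructor
  · rintro rfl i j hj
    rw [extend_apply _ i hj, restrict]
  · intro h
    funext i j
    rw [restrict, h i j j.2, extend_apply z i j.2]

lemma integral_finite {α : Type*} [Fintype α] [MeasurableSpace α] [MeasurableSingletonClass α]
    {Z : Ω → α} (hZ : Measurable Z) (f : α → ℝ) :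
    ∫ ω, f (Z ω) ∂μ = ∑ z, μ.real {ω | Z ω = z} * f z := by
  have : IsProbabilityMeasure (μ.map Z) := Measure.isProbabilityMeasure_map hZ.aemeasurable
  rw [← integral_map (f := f) hZ.aemeasurable
    (measurable_of_finite f).aestronglyMeasurable, integral_fintype (Integrable.of_finite)]
  refine Finset.sum_congr rfl fun z _ => ?_
  rw [map_measureReal_apply hZ (measurableSet_singleton z), smul_eq_mul]
  rfl

/-- The mean of a function of the slots before `m + l`. -/
lemma integral_past (hX : IsMarkovErasureChannel μ p X) {n m : ℕ} {H : (ℕ → ℕ → Bool) → ℝ}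
    (hH : DependsOnFirst n (m + l) H) :
    ∫ ω, H (fun i j => X i j ω) ∂μ = ∑ z : Fin n → Fin (m + l) → Bool, H (extend z) *
      ∏ i : Fin n, μ.real {ω | ∀ j < m + l, X i j ω = extend z i j} := by
  have hmeas := hX.measurable_restrict n (m + l) 0
  simp only [Nat.zero_add] at hmeas
  have h := integral_finite (μ := μ) hmeas fun z => H (extend z)
  simp only [hH.extend_restrict, restrict_eq_iff] at h
  rw [h]
  refine Finset.sum_congr rfl fun z _ => ?_
  rw [mul_comm, ← hX.measureReal_past]

/-- The mean of the product of a function of the slots before `m + l` and a function of a window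
that starts `G` slots later. -/
lemma integral_past_mul_window (hX : IsMarkovErasureChannel μ p X) {n m W : ℕ} (G : ℕ)
    {H F : (ℕ → ℕ → Bool) → ℝ} (hH : DependsOnFirst n (m + l) H) (hF : DependsOnFirst n W F) :
    ∫ ω, H (fun i j => X i j ω) * F (fun i j => X i (m + l + G + j) ω) ∂μ =
      ∑ z : Fin n → Fin (m + l) → Bool, H (extend z) *
        (∏ i : Fin n, μ.real {ω | ∀ j < m + l, X i j ω = extend z i j}) *
          gapMean p n W G F fun i => history l m (extend z i) := by
  have hmeas := hX.measurable_restrict n (m + l) 0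
  simp only [Nat.zero_add] at hmeas
  have h := integral_finite (μ := μ) (hmeas.prodMk (hX.measurable_restrict n W (m + l + G)))
    fun z => H (extend z.1) * F (extend z.2)
  simp only [hH.extend_restrict, hF.extend_restrict] at h
  rw [h, Fintype.sum_prod_type]
  refine Finset.sum_congr rfl fun z _ => ?_
  rw [gapMean, Finset.mul_sum]
  refine Finset.sum_congr rfl fun w _ => ?_
  have hset : {ω | (restrict n (m + l) (fun i j => X i j ω),
      restrict n W fun i j => X i (m + l + G + j) ω) = (z, w)} =
      {ω | ∀ i : Fin n, (∀ j < m + l, X i j ω = extend z i j) ∧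
        ∀ j < W, X i (m + l + G + j) ω = extend w i j} := by
    ext ω
    simp only [Set.mem_ofPred_eq, Prod.mk.injEq, restrict_eq_iff, forall_and]
  rw [hset, hX.measureReal_joint]
  ring

end IsMarkovErasureChannel

end JointLaw

/-! ### Exponential concentration of window sums. -/

section Concentration

variable {Ω : Type*} [MeasurableSpace Ω] {μ : Measure Ω} [IsProbabilityMeasure μ]
  {l : ℕ} {p : (Fin l → Bool) → ℝ} {X : ℕ → ℕ → Ω → Bool}

lemma exp_le_one_add_add_sq {x : ℝ} (hx : |x| ≤ 1) : Real.exp x ≤ 1 + x + x ^ 2 := by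
  have := (abs_le.1 (Real.abs_exp_sub_one_sub_id_le hx)).2
  linarith

/-- An exponential tail bound for sums of bounded variables whose conditional means are at
most `ε`. -/
lemma measureReal_sum_ge_le {D : ℕ → Ω → ℝ} (hD : ∀ k, Measurable (D k)) {R ε : ℝ}
    (hR : 1 ≤ R) (hbd : ∀ k ω, |D k ω| ≤ R) (hε : 0 < ε) (hε1 : ε ≤ 1)
    (h : ∀ k, ∫ ω, Real.exp (ε / R ^ 2 * ∑ i ∈ Finset.range k, D i ω) * D k ω ∂μ ≤
      ε * ∫ ω, Real.exp (ε / R ^ 2 * ∑ i ∈ Finset.range k, D i ω) ∂μ) (t : ℕ) :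
    μ.real {ω | 3 * ε * t ≤ ∑ i ∈ Finset.range t, D i ω} ≤ Real.exp (-(ε ^ 2 / R ^ 2) * t) := by
  -- With this choice `θ * R ≤ 1` and `(θ * R) ^ 2 = θ * ε`, so the quadratic term of the
  -- exponential costs no more than the drift.
  set θ := ε / R ^ 2 with hθ
  have hR2 : (0 : ℝ) < R ^ 2 := by positivity
  have hθ0 : 0 < θ := by positivity
  have hsum : ∀ k ω, |∑ i ∈ Finset.range k, D i ω| ≤ k * R := fun k ω =>
    (Finset.abs_sum_le_sum_abs _ _).trans
      ((Finset.sum_le_sum fun i _ => hbd i ω).trans_eq (by simp))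
  have hSm : ∀ k, Measurable fun ω => ∑ i ∈ Finset.range k, D i ω := fun k =>
    Finset.measurable_sum _ fun i _ => hD i
  have hEm : ∀ k, Measurable fun ω => Real.exp (θ * ∑ i ∈ Finset.range k, D i ω) := fun k =>
    Real.measurable_exp.comp ((hSm k).const_mul θ)
  have hEb : ∀ k ω, |Real.exp (θ * ∑ i ∈ Finset.range k, D i ω)| ≤ Real.exp (θ * (k * R)) :=
    fun k ω => by
      rw [abs_of_pos (Real.exp_pos _)]
      gcongr
      exact (abs_le.1 (hsum k ω)).2
  have hEi : ∀ k, Integrable (fun ω => Real.exp (θ * ∑ i ∈ Finset.range k, D i ω)) μ := fun k =>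
    Integrable.of_bound (hEm k).aestronglyMeasurable _ (Eventually.of_forall (hEb k))
  have hEDi : ∀ k, Integrable
      (fun ω => Real.exp (θ * ∑ i ∈ Finset.range k, D i ω) * D k ω) μ := fun k =>
    (hEi k).mul_bdd (c := R) (hD k).aestronglyMeasurable (Eventually.of_forall (hbd k))
  have hmgf : ∀ k : ℕ, ∫ ω, Real.exp (θ * ∑ i ∈ Finset.range k, D i ω) ∂μ ≤
      Real.exp (2 * (ε ^ 2 / R ^ 2) * k) := by
    intro k
    induction k with
    | zero => simp
    | succ k ih =>
      have hpt : ∀ ω, Real.exp (θ * ∑ i ∈ Finset.range (k + 1), D i ω) ≤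
          (1 + θ * ε) * Real.exp (θ * ∑ i ∈ Finset.range k, D i ω) +
            θ * (Real.exp (θ * ∑ i ∈ Finset.range k, D i ω) * D k ω) := by
        intro ω
        have h1 : |θ * D k ω| ≤ θ * R := by
          rw [abs_mul, abs_of_pos hθ0]
          exact mul_le_mul_of_nonneg_left (hbd k ω) hθ0.le
        have h2 : θ * R ≤ 1 := by
          rw [hθ, div_mul_eq_mul_div, div_le_one hR2]
          nlinarith
        have h3 := exp_le_one_add_add_sq (h1.trans h2)
        have h4 : (θ * D k ω) ^ 2 ≤ θ * ε := by
          rw [← sq_abs]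
          calc |θ * D k ω| ^ 2 ≤ (θ * R) ^ 2 := by gcongr
            _ = θ * ε := by rw [hθ]; field_simp
        rw [Finset.sum_range_succ, mul_add, Real.exp_add]
        have h5 := mul_le_mul_of_nonneg_left (h3.trans (add_le_add_right h4 _))
          (Real.exp_pos (θ * ∑ i ∈ Finset.range k, D i ω)).le
        linarith
      have hint := integral_mono (hEi (k + 1))
        (((hEi k).const_mul (1 + θ * ε)).add ((hEDi k).const_mul θ)) hpt
      simp only [Pi.add_apply] at hint
      rw [integral_add ((hEi k).const_mul _) ((hEDi k).const_mul _), integral_const_mul,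
        integral_const_mul] at hint
      have h6 := mul_le_mul_of_nonneg_left (h k) hθ0.le
      have hE0 : 0 ≤ ∫ ω, Real.exp (θ * ∑ i ∈ Finset.range k, D i ω) ∂μ :=
        integral_nonneg fun ω => (Real.exp_pos _).le
      have h7 : 1 + 2 * (θ * ε) ≤ Real.exp (2 * (ε ^ 2 / R ^ 2)) := by
        have := Real.add_one_le_exp (2 * (ε ^ 2 / R ^ 2))
        have he : θ * ε = ε ^ 2 / R ^ 2 := by rw [hθ]; ring
        rw [he]
        linarith
      calc _ ≤ (1 + 2 * (θ * ε)) * ∫ ω, Real.exp (θ * ∑ i ∈ Finset.range k, D i ω) ∂μ := by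
            linarith
        _ ≤ Real.exp (2 * (ε ^ 2 / R ^ 2)) * Real.exp (2 * (ε ^ 2 / R ^ 2) * k) :=
            mul_le_mul h7 ih hE0 (Real.exp_pos _).le
        _ = _ := by
            rw [← Real.exp_add]
            push_cast
            ring_nf
  -- The threshold `3ε` beats the growth rate of the moment generating function: the exponent per
  -- step is `(-3 + 2) * ε ^ 2 / R ^ 2`.
  have hmarkov := measure_ge_le_exp_mul_mgf (μ := μ)
    (X := fun ω => ∑ i ∈ Finset.range t, D i ω) (3 * ε * t) hθ0.le (hEi t)
  refine hmarkov.trans ?_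
  calc Real.exp (-θ * (3 * ε * t)) * mgf (fun ω => ∑ i ∈ Finset.range t, D i ω) μ θ
      ≤ Real.exp (-θ * (3 * ε * t)) * Real.exp (2 * (ε ^ 2 / R ^ 2) * t) :=
        mul_le_mul_of_nonneg_left (hmgf t) (Real.exp_pos _).le
    _ = _ := by
        rw [← Real.exp_add, hθ]
        congr 1
        ring

/-- The mean is a finite sum of products of one-channel probabilities, each of which forgets its
history. -/
lemma exists_tendsto_gapMean (hP : IsStochastic (transitionMatrix p))
    (hprim : (transitionMatrix p).IsPrimitive) (n W : ℕ) (F : (ℕ → ℕ → Bool) → ℝ) :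
    ∃ c, ∀ s : Fin n → Fin l → Bool,
      Tendsto (fun G => gapMean p n W G F s) atTop (𝓝 c) := by
  choose v hv using fun w : ℕ → Bool =>
    hP.exists_tendsto_pow_mulVec hprim fun u => pathProb p W u w
  refine ⟨∑ w : Fin n → Fin W → Bool, F (extend w) * ∏ i : Fin n, v (extend w i), fun s => ?_⟩
  exact tendsto_finsetSum _ fun w _ => (tendsto_finsetProd _ fun i _ => hv _ _).const_mul _

/-- Averaging over `B` adjacent windows drowns the first ones, which still remember the history, so
no mixing gap has to be left out. There are finitely many histories, hence one `B` for all. -/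
lemma exists_sum_gapMean_le {n W : ℕ} (hW : 1 ≤ W) {F : (ℕ → ℕ → Bool) → ℝ} {c : ℝ}
    (hc : ∀ s : Fin n → Fin l → Bool, Tendsto (fun G => gapMean p n W G F s) atTop (𝓝 c))
    {ε : ℝ} (hε : 0 < ε) : ∃ B : ℕ, 1 ≤ B ∧ ∀ s : Fin n → Fin l → Bool,
      |(∑ k ∈ Finset.range B, gapMean p n W (W * k) F s) / B - c| ≤ ε := by
  have h : ∀ s : Fin n → Fin l → Bool, ∀ᶠ B : ℕ in atTop,
      |(∑ k ∈ Finset.range B, gapMean p n W (W * k) F s) / B - c| ≤ ε := by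
    intro s
    have h1 := ((hc s).comp (tendsto_id.const_mul_atTop' hW)).cesaro
    filter_upwards [h1.eventually (Metric.closedBall_mem_nhds c hε)] with B hB
    rw [Real.dist_eq, inv_mul_eq_div] at hB
    exact hB
  obtain ⟨B, hB, hB1⟩ := ((eventually_all.2 h).and (eventually_ge_atTop 1)).exists
  exact ⟨B, hB1, hB⟩

namespace IsMarkovErasureChannel

/-- A bound on the conditional mean of a group average given the past, tested against nonnegative
functions `H` of the past instead of stated with conditional expectations. The sign `σ` serves both
tails. -/
lemma integral_past_mul_average (hX : IsMarkovErasureChannel μ p X) {n W B : ℕ}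
    {F : (ℕ → ℕ → Bool) → ℝ} (hF : DependsOnFirst n W F) (hb : ∀ x, |F x| ≤ 1) {c ε σ : ℝ}
    (hσ : |σ| = 1)
    (hm : ∀ s : Fin n → Fin l → Bool,
      |(∑ k ∈ Finset.range B, gapMean p n W (W * k) F s) / B - c| ≤ ε)
    {m : ℕ} {H : (ℕ → ℕ → Bool) → ℝ} (hH : DependsOnFirst n (m + l) H) (hH0 : ∀ x, 0 ≤ H x) :
    ∫ ω, H (fun i j => X i j ω) *
      (σ * ((∑ k ∈ Finset.range B, F fun i j => X i (m + l + W * k + j) ω) / B - c)) ∂μ ≤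
      ε * ∫ ω, H (fun i j => X i j ω) ∂μ := by
  have hHm := hX.measurable_of_dependsOnFirst hH 0
  simp only [Nat.zero_add] at hHm
  have hHi : Integrable (fun ω => H fun i j => X i j ω) μ := by
    obtain ⟨A, hA⟩ := (Set.finite_range fun z : Fin n → Fin (m + l) → Bool =>
      H (extend z)).bddAbove
    refine Integrable.of_bound hHm.aestronglyMeasurable A (Eventually.of_forall fun ω => ?_)
    rw [Real.norm_of_nonneg (hH0 _), ← hH.extend_restrict]
    exact hA ⟨_, rfl⟩
  have hHFi : ∀ k, Integrable
      (fun ω => H (fun i j => X i j ω) * F fun i j => X i (m + l + W * k + j) ω) μ := fun k =>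
    hHi.mul_bdd (c := 1) (hX.measurable_of_dependsOnFirst hF _).aestronglyMeasurable
      (Eventually.of_forall fun ω => hb _)
  have hrw : ∀ ω, H (fun i j => X i j ω) *
      (σ * ((∑ k ∈ Finset.range B, F fun i j => X i (m + l + W * k + j) ω) / B - c)) =
      σ / B * (∑ k ∈ Finset.range B,
        H (fun i j => X i j ω) * F fun i j => X i (m + l + W * k + j) ω) -
      σ * c * H (fun i j => X i j ω) := fun ω => by
    rw [← Finset.mul_sum]
    ring
  simp only [hrw]
  rw [integral_sub ((integrable_finsetSum _ fun k _ => hHFi k).const_mul _) (hHi.const_mul _),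
    integral_const_mul, integral_const_mul, integral_finsetSum _ fun k _ => hHFi k]
  simp only [hX.integral_past_mul_window _ hH hF]
  rw [hX.integral_past hH, Finset.sum_comm, Finset.mul_sum, Finset.mul_sum, Finset.mul_sum,
    ← Finset.sum_sub_distrib]
  refine Finset.sum_le_sum fun z _ => ?_
  rw [← Finset.mul_sum]
  set q := H (extend z) * ∏ i : Fin n, μ.real {ω | ∀ j < m + l, X i j ω = extend z i j} with hq
  have hq0 : 0 ≤ q := mul_nonneg (hH0 _) (Finset.prod_nonneg fun i _ => measureReal_nonneg)
  have h1 := hm fun i => history l m (extend z i)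
  set g := (∑ k ∈ Finset.range B, gapMean p n W (W * k) F fun i => history l m (extend z i))
    with hg
  have h2 : σ * (g / B - c) ≤ ε := by
    refine (le_abs_self _).trans ?_
    rw [abs_mul, hσ, one_mul]
    exact h1
  calc σ / B * (q * g) - σ * c * q = (σ * (g / B - c)) * q := by ring
    _ ≤ ε * q := mul_le_mul_of_nonneg_right h2 hq0

end IsMarkovErasureChannel

/-- The signed deviation from `c` of the mean of `F` over the windows of the `k`-th group of `B`
windows of length `W`. -/
def deviation (F : (ℕ → ℕ → Bool) → ℝ) (a l W B : ℕ) (c σ : ℝ) (k : ℕ) (x : ℕ → ℕ → Bool) : ℝ :=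
  σ * ((∑ j ∈ Finset.range B, F fun i j' => x i (a + W * (B * k) + l + W * j + j')) / B - c)

lemma dependsOnFirst_deviation {n W : ℕ} {F : (ℕ → ℕ → Bool) → ℝ} (hF : DependsOnFirst n W F)
    (a l B : ℕ) (c σ : ℝ) (k : ℕ) {M : ℕ} (hM : a + W * (B * (k + 1)) + l ≤ M) :
    DependsOnFirst n M (deviation F a l W B c σ k) := by
  intro x y hxy
  unfold deviation
  congr 3
  refine Finset.sum_congr rfl fun j hj => hF _ _ fun i hi j' hj' => hxy i hi _ ?_
  rw [Finset.mem_range] at hj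
  have h1 : W * (B * k + j + 1) ≤ W * (B * (k + 1)) := Nat.mul_le_mul_left W (by
    rw [mul_add, mul_one]; omega)
  rw [mul_add, mul_add] at h1
  omega

lemma abs_deviation_le {F : (ℕ → ℕ → Bool) → ℝ} (hb : ∀ x, |F x| ≤ 1) (a l W : ℕ) {B : ℕ}
    (hB : 1 ≤ B) (c : ℝ) {σ : ℝ} (hσ : |σ| = 1) (k : ℕ) (x : ℕ → ℕ → Bool) :
    |deviation F a l W B c σ k x| ≤ 1 + |c| := by
  have hB0 : (0 : ℝ) < B := by exact_mod_cast hB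
  unfold deviation
  rw [abs_mul, hσ, one_mul]
  refine (abs_sub _ _).trans (add_le_add_left ?_ _)
  rw [abs_div, abs_of_pos hB0, div_le_one hB0]
  exact (Finset.abs_sum_le_sum_abs _ _).trans
    ((Finset.sum_le_sum fun i _ => hb _).trans_eq (by simp))

/-- The exponential of the earlier deviations is a nonnegative function of the past of group `k`, so
`integral_past_mul_average` supplies the drift hypothesis of `measureReal_sum_ge_le`. -/
lemma IsMarkovErasureChannel.measureReal_sum_deviation_ge_le (hX : IsMarkovErasureChannel μ p X)
    {n W B : ℕ} (hB : 1 ≤ B) {F : (ℕ → ℕ → Bool) → ℝ} (hF : DependsOnFirst n W F)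
    (hb : ∀ x, |F x| ≤ 1) {c δ σ : ℝ} (hσ : |σ| = 1) (hδ : 0 < δ) (hδ1 : δ ≤ 1)
    (hm : ∀ s : Fin n → Fin l → Bool,
      |(∑ k ∈ Finset.range B, gapMean p n W (W * k) F s) / B - c| ≤ δ) (a q : ℕ) :
    μ.real {ω | 3 * δ * q ≤ ∑ k ∈ Finset.range q, deviation F a l W B c σ k fun i j => X i j ω} ≤
      Real.exp (-(δ ^ 2 / (1 + |c|) ^ 2) * q) := by
  refine measureReal_sum_ge_le (D := fun k ω => deviation F a l W B c σ k fun i j => X i j ω)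
    (fun k => ?_) (le_add_of_nonneg_right (abs_nonneg c))
    (fun k ω => abs_deviation_le hb a l W hB c hσ k _) hδ hδ1 (fun k => ?_) q
  · simpa using hX.measurable_of_dependsOnFirst (dependsOnFirst_deviation hF a l B c σ k le_rfl) 0
  · refine hX.integral_past_mul_average (m := a + W * (B * k)) hF hb hσ hm
      (H := fun x => Real.exp (δ / (1 + |c|) ^ 2 *
        ∑ i ∈ Finset.range k, deviation F a l W B c σ i x)) ?_ fun x => (Real.exp_pos _).le
    intro x y hxy
    simp only
    congr 2
    refine Finset.sum_congr rfl fun k' hk' =>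
      dependsOnFirst_deviation hF a l B c σ k' ?_ x y hxy
    rw [Finset.mem_range] at hk'
    have : W * (B * (k' + 1)) ≤ W * (B * k) :=
      Nat.mul_le_mul_left _ (Nat.mul_le_mul_left _ hk')
    omega

/-- The complete groups and the `r` leftover terms each use at most half of the allowance `ε * (B *
q + r)`. -/
lemma abs_sum_sub_lt {f : ℕ → ℝ} (hf : ∀ k, |f k| ≤ 1) {B q r : ℕ} (hr : r < B)
    {c δ ε : ℝ} (hε : 0 < ε) (hδε : 6 * δ ≤ ε)
    (habs : |∑ k ∈ Finset.range q, ((∑ j ∈ Finset.range B, f (B * k + j)) / B - c)| ≤ 3 * δ * q)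
    (hT : 2 * B * (1 + |c|) < ε * (B * q + r)) :
    |∑ k ∈ Finset.range (B * q + r), f k - c * (B * q + r)| < ε * (B * q + r) := by
  have hB0 : (0 : ℝ) < B := by exact_mod_cast (Nat.zero_le r).trans_lt hr
  have hr' : (r : ℝ) ≤ B := by exact_mod_cast hr.le
  have hgroup : ∀ q : ℕ, ∑ k ∈ Finset.range (B * q), f k =
      ∑ k ∈ Finset.range q, ∑ j ∈ Finset.range B, f (B * k + j) := by
    intro q
    induction q with
    | zero => simp
    | succ q ih => rw [mul_add, mul_one, Finset.sum_range_add, ih, Finset.sum_range_succ]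
  simp only [Finset.sum_sub_distrib, ← Finset.sum_div, ← hgroup, Finset.sum_const,
    Finset.card_range, nsmul_eq_mul] at habs
  have hrest : |∑ k ∈ Finset.range r, f (B * q + k)| ≤ r :=
    (Finset.abs_sum_le_sum_abs _ _).trans ((Finset.sum_le_sum fun i _ => hf _).trans_eq (by simp))
  have hmain : |(∑ k ∈ Finset.range (B * q), f k) - c * (B * q)| ≤ 3 * δ * q * B := by
    have h1 : (∑ k ∈ Finset.range (B * q), f k) - c * (B * q) =
        ((∑ k ∈ Finset.range (B * q), f k) / B - q * c) * B := by
      field_simp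
    rw [h1, abs_mul, abs_of_pos hB0]
    exact mul_le_mul_of_nonneg_right habs hB0.le
  have hcr : |c * r| ≤ |c| * B := by
    rw [abs_mul, Nat.abs_cast]
    exact mul_le_mul_of_nonneg_left hr' (abs_nonneg c)
  have hBq : 6 * δ * (B * q) ≤ ε * (B * q) := mul_le_mul_of_nonneg_right hδε (by positivity)
  have hεr : 0 ≤ ε * r := by positivity
  rw [Finset.sum_range_add, show ∑ k ∈ Finset.range (B * q), f k +
    ∑ k ∈ Finset.range r, f (B * q + k) - c * (B * q + r) =
    (∑ k ∈ Finset.range (B * q), f k - c * (B * q)) +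
      ∑ k ∈ Finset.range r, f (B * q + k) - c * r by ring]
  refine (abs_sub _ _).trans_lt ((add_le_add_left (abs_add_le _ _) _).trans_lt ?_)
  linarith

/-- Sums of a bounded function over consecutive windows concentrate exponentially, uniformly in
the channel and in the slot in which the first window starts. -/
theorem exists_concentration {n W : ℕ} (hW : 1 ≤ W)
    {F : (ℕ → ℕ → Bool) → ℝ} (hF : DependsOnFirst n W F) (hb : ∀ x, |F x| ≤ 1) {c : ℝ}
    (hc : ∀ s : Fin n → Fin l → Bool, Tendsto (fun G => gapMean p n W G F s) atTop (𝓝 c))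
    {ε : ℝ} (hε : 0 < ε) : ∃ C κ : ℝ, 0 < κ ∧ 0 ≤ C ∧
      ∀ X : ℕ → ℕ → Ω → Bool, IsMarkovErasureChannel μ p X → ∀ a t : ℕ,
        μ.real {ω | ε * t ≤ |∑ k ∈ Finset.range t,
          F (fun i j => X i (l + (a + W * k) + j) ω) - c * t|} ≤ C * Real.exp (-κ * t) := by
  obtain ⟨δ, hδ, hδ1, hδε⟩ : ∃ δ : ℝ, 0 < δ ∧ δ ≤ 1 ∧ 6 * δ ≤ ε :=
    ⟨min 1 (ε / 6), by positivity, min_le_left _ _, by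
      have := min_le_right 1 (ε / 6)
      linarith⟩
  obtain ⟨B, hB, hmean⟩ := exists_sum_gapMean_le hW hc hδ
  have hB0 : (0 : ℝ) < B := by exact_mod_cast hB
  set R := 1 + |c| with hR
  have hR1 : 1 ≤ R := by have := abs_nonneg c; linarith
  set κ' := δ ^ 2 / R ^ 2 with hκ'
  have hκ'0 : 0 < κ' := by positivity
  set T := 2 * B * R / ε + 1 with hT
  -- The last summand makes the bound trivial for `t < T`. The `2` counts the two tails, and `exp
  -- κ'` pays for rounding `t` down to complete groups.
  refine ⟨2 * Real.exp κ' + Real.exp (κ' / B * T), κ' / B, by positivity, by positivity,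
    fun X hX a t => ?_⟩
  set D : ℝ → ℕ → (ℕ → ℕ → Bool) → ℝ := deviation F a l W B c with hD
  have htail : ∀ σ : ℝ, |σ| = 1 → ∀ q : ℕ,
      μ.real {ω | 3 * δ * q ≤ ∑ k ∈ Finset.range q, D σ k fun i j => X i j ω} ≤
        Real.exp (-κ' * q) := fun σ hσ q =>
    hX.measureReal_sum_deviation_ge_le hB hF hb hσ hδ hδ1 hmean a q
  rcases lt_or_ge (t : ℝ) T with htT | htT
  · calc _ ≤ (1 : ℝ) := measureReal_le_one
      _ ≤ Real.exp (κ' / B * T) * Real.exp (-(κ' / B) * t) := by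
          rw [← Real.exp_add]
          refine Real.one_le_exp ?_
          have : 0 ≤ κ' / B * (T - t) := mul_nonneg (by positivity) (by linarith)
          linarith
      _ ≤ _ := by
          gcongr
          have := Real.exp_pos κ'
          linarith
  set q := t / B with hq
  obtain ⟨r, hr, hrt⟩ : ∃ r < B, t = B * q + r :=
    ⟨t % B, Nat.mod_lt _ hB, (Nat.div_add_mod t B).symm⟩
  have hsub : {ω | ε * t ≤ |∑ k ∈ Finset.range t,
      F (fun i j => X i (l + (a + W * k) + j) ω) - c * t|} ⊆
      {ω | 3 * δ * q ≤ ∑ k ∈ Finset.range q, D 1 k fun i j => X i j ω} ∪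
      {ω | 3 * δ * q ≤ ∑ k ∈ Finset.range q, D (-1) k fun i j => X i j ω} := by
    intro ω hω
    by_contra hcon
    simp only [Set.mem_union, Set.mem_ofPred_eq, not_or, not_le] at hcon hω
    set f : ℕ → ℝ := fun k => F (fun i j => X i (l + (a + W * k) + j) ω) with hf
    have hDf : ∀ σ k, D σ k (fun i j => X i j ω) =
        σ * ((∑ j ∈ Finset.range B, f (B * k + j)) / B - c) := by
      intro σ k
      simp only [hD, deviation, hf]
      congr 4
      funext j
      congr 1
      funext i j'
      congr 1
      ring
    simp only [hDf, ← Finset.mul_sum] at hcon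
    have htR : 2 * B * R < ε * (B * q + r) := by
      have h1 : 2 * B * R / ε < t := by linarith
      rw [div_lt_iff₀ hε, hrt] at h1
      push_cast at h1
      linarith
    have hlt := abs_sum_sub_lt (fun k => hb _) hr hε hδε
      (abs_le.2 ⟨by linarith [hcon.2], by linarith [hcon.1]⟩) htR (f := f)
    rw [hrt] at hω
    push_cast at hω
    exact absurd hω (not_le.2 hlt)
  refine (measureReal_mono hsub).trans ((measureReal_union_le _ _).trans ?_)
  have h1 := htail 1 (by simp) q
  have h2 := htail (-1) (by simp) q
  have h3 : Real.exp (-κ' * q) ≤ Real.exp κ' * Real.exp (-(κ' / B) * t) := by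
    rw [← Real.exp_add]
    refine Real.exp_le_exp.2 ?_
    have h4 : (t : ℝ) ≤ B * (q + 1) := by
      rw [hrt]
      push_cast
      have hr' : (r : ℝ) ≤ B := by exact_mod_cast hr.le
      linarith
    have h5 : κ' / B * t ≤ κ' / B * (B * (q + 1)) :=
      mul_le_mul_of_nonneg_left h4 (by positivity)
    have h6 : κ' / B * (B * (q + 1)) = κ' * (q + 1) := by field_simp
    linarith
  have h7 : 0 ≤ Real.exp (κ' / B * T) * Real.exp (-(κ' / B) * t) := by positivity
  linarith

end Concentration

/-! ### Existence of the throughput. -/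

section LawOfLargeNumbers

variable {Ω : Type*} [MeasurableSpace Ω] {μ : Measure Ω}
  {l : ℕ} {p : (Fin l → Bool) → ℝ} {X : ℕ → ℕ → Ω → Bool}

/-- A strong law of large numbers from exponential tail bounds. -/
lemma ae_tendsto_div_of_tail [IsFiniteMeasure μ] {Z : ℕ → Ω → ℝ} {c : ℝ}
    (h : ∀ ε : ℝ, 0 < ε → ∃ C κ : ℝ, 0 < κ ∧ 0 ≤ C ∧ ∀ t : ℕ,
      μ.real {ω | ε * t ≤ |Z t ω - c * t|} ≤ C * Real.exp (-κ * t)) :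
    ∀ᵐ ω ∂μ, Tendsto (fun t : ℕ => Z t ω / t) atTop (𝓝 c) := by
  have hae : ∀ ε : ℝ, 0 < ε → ∀ᵐ ω ∂μ, ∀ᶠ t : ℕ in atTop, |Z t ω - c * t| < ε * t := by
    intro ε hε
    obtain ⟨C, κ, hκ, hC, hbd⟩ := h ε hε
    have hsum : Summable fun t : ℕ => C * Real.exp (-κ * t) := by
      refine Summable.mul_left C ?_
      have h1 : ∀ t : ℕ, Real.exp (-κ * t) = Real.exp (-κ) ^ t := fun t => by
        rw [← Real.exp_nat_mul]
        ring_nf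
      simp only [h1]
      exact summable_geometric_of_lt_one (Real.exp_pos _).le
        (Real.exp_lt_one_iff.2 (by linarith))
    have hne : ∑' t : ℕ, μ {ω | ε * t ≤ |Z t ω - c * t|} ≠ ⊤ := by
      refine ne_top_of_le_ne_top hsum.tsum_ofReal_ne_top (ENNReal.tsum_le_tsum fun t => ?_)
      rw [← ofReal_measureReal]
      exact ENNReal.ofReal_le_ofReal (hbd t)
    filter_upwards [ae_eventually_notMem hne] with ω hω
    filter_upwards [hω] with t ht
    simpa using ht
  have hall : ∀ᵐ ω ∂μ, ∀ k : ℕ, ∀ᶠ t : ℕ in atTop,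
      |Z t ω - c * t| < 1 / ((k : ℝ) + 1) * t :=
    ae_all_iff.2 fun k => hae _ (by positivity)
  filter_upwards [hall] with ω hω
  rw [Metric.tendsto_atTop']
  intro ε hε
  obtain ⟨k, hk⟩ := exists_nat_one_div_lt hε
  obtain ⟨T, hT⟩ := eventually_atTop.1 ((hω k).and (eventually_gt_atTop 0))
  refine ⟨T, fun t ht => ?_⟩
  obtain ⟨h1, h2⟩ := hT t ht.le
  have ht0 : (0 : ℝ) < t := by exact_mod_cast h2
  rw [Real.dist_eq, show Z t ω / t - c = (Z t ω - c * t) / t by field_simp, abs_div,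
    abs_of_pos ht0, div_lt_iff₀ ht0]
  exact h1.trans (mul_lt_mul_of_pos_right hk ht0)

/-- A function that is eventually close to each of the intervals `[c W, c W + 1 / W]` converges
to a limit that is determined by these intervals. -/
lemma tendsto_iSup_of_eventually_between {f c : ℕ → ℝ}
    (h : ∀ W : ℕ, 1 ≤ W → ∀ ε : ℝ, 0 < ε →
      ∀ᶠ t in atTop, c W - ε ≤ f t ∧ f t ≤ c W + 1 / W + ε) :
    Tendsto f atTop (𝓝 (⨆ V : ℕ, c (V + 1))) := by
  -- A lower bound from `V` and an upper bound from `W` hold at a common `t`; hence the supremum is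
  -- within `1 / W` of `c W`.
  have hle : ∀ V W : ℕ, 1 ≤ V → 1 ≤ W → c V ≤ c W + 1 / W := by
    intro V W hV hW
    refine le_of_forall_pos_le_add fun ε hε => ?_
    obtain ⟨t, h1, h2⟩ := ((h V hV (ε / 2) (by positivity)).and
      (h W hW (ε / 2) (by positivity))).exists
    linarith [h1.1, h2.2]
  have hbdd : BddAbove (Set.range fun V : ℕ => c (V + 1)) := ⟨c 1 + 1 / (1 : ℕ), by
    rintro _ ⟨V, rfl⟩
    exact hle _ 1 (by omega) le_rfl⟩
  rw [Metric.tendsto_atTop]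
  intro ε hε
  obtain ⟨W, hW⟩ := exists_nat_one_div_lt (half_pos hε)
  have h1 : c (W + 1) ≤ ⨆ V : ℕ, c (V + 1) := le_ciSup hbdd W
  have h2 : ⨆ V : ℕ, c (V + 1) ≤ c (W + 1) + 1 / ((W + 1 : ℕ) : ℝ) :=
    ciSup_le fun V => hle _ _ (by omega) (by omega)
  obtain ⟨T, hT⟩ := eventually_atTop.1 (h (W + 1) (by omega) (ε / 4) (by positivity))
  refine ⟨T, fun t ht => ?_⟩
  obtain ⟨h3, h4⟩ := hT t ht
  push_cast at h2 h4
  rw [Real.dist_eq, abs_lt]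
  constructor <;> linarith

/-- The number of blocks per slot that are completed in a window of length `W`. -/
def windowRate (n K W : ℕ) (x : ℕ → ℕ → Bool) : ℝ := (blocksIn x n K 0 W : ℝ) / W

lemma dependsOnFirst_windowRate (n K W : ℕ) : DependsOnFirst n W (windowRate n K W) := by
  intro x y h
  unfold windowRate
  rw [blocksIn_congr fun i hi j _ hj => h i hi j hj]

lemma abs_windowRate_le {n K : ℕ} (hn : 1 ≤ n) (hK : 1 ≤ K) (W : ℕ) (x : ℕ → ℕ → Bool) :
    |windowRate n K W x| ≤ 1 := by
  unfold windowRate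
  rw [abs_of_nonneg (by positivity)]
  refine div_le_one_of_le₀ ?_ (by positivity)
  exact_mod_cast blocksIn_le (x := x) hn hK (Nat.zero_le W)

lemma mul_windowRate {n K W : ℕ} (hW : 1 ≤ W) (x : ℕ → ℕ → Bool) (s : ℕ) :
    W * windowRate n K W (fun i j => x i (s + j)) = blocksIn x n K s (s + W) := by
  have hW0 : (W : ℝ) ≠ 0 := by positivity
  unfold windowRate
  rw [mul_div_cancel₀ _ hW0, blocksIn_shift, Nat.add_zero]

/-- Superadditivity gives the lower bound; one straddling block per window accounts for `1 / W` in
the upper bound. A general `t` is squeezed between adjacent multiples of `W`, at the cost of factors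
`N / (N + 1)`. -/
lemma eventually_blocksIn_div_between {n K W : ℕ} (hn : 1 ≤ n) (hK : 1 ≤ K) (hW : 1 ≤ W)
    {x : ℕ → ℕ → Bool} {c : ℝ}
    (hc : Tendsto (fun N : ℕ => (∑ k ∈ Finset.range N,
      windowRate n K W fun i j => x i (W * k + j)) / (N : ℝ)) atTop (𝓝 c)) {ε : ℝ} (hε : 0 < ε) :
    ∀ᶠ t : ℕ in atTop, c - ε ≤ (blocksIn x n K 0 t : ℝ) / t ∧
      (blocksIn x n K 0 t : ℝ) / t ≤ c + 1 / W + ε := by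
  have hW0 : (0 : ℝ) < W := by exact_mod_cast hW
  set S : ℕ → ℝ := fun N => ∑ k ∈ Finset.range N, windowRate n K W fun i j => x i (W * k + j)
    with hS
  have hS0 : ∀ N, 0 ≤ S N := fun N => Finset.sum_nonneg fun k _ => by
    unfold windowRate
    positivity
  have hlow : ∀ N, W * S N ≤ blocksIn x n K 0 (W * N) := fun N => by
    have h := sum_blocksIn_le (x := x) hn hK 0 W N
    simp only [Nat.zero_add] at h
    simp only [hS, Finset.mul_sum, mul_windowRate hW]
    exact_mod_cast h
  have hupp : ∀ N, (blocksIn x n K 0 (W * N) : ℝ) ≤ W * S N + N := fun N => by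
    have h := blocksIn_le_sum (x := x) hn hK 0 W N
    simp only [Nat.zero_add, Finset.sum_add_distrib, Finset.sum_const, Finset.card_range,
      smul_eq_mul, mul_one] at h
    simp only [hS, Finset.mul_sum, mul_windowRate hW]
    exact_mod_cast h
  have hdiv : Tendsto (fun t : ℕ => t / W) atTop atTop :=
    Nat.tendsto_div_const_atTop (by omega)
  have hratio : Tendsto (fun N : ℕ => (N : ℝ) / (N + 1)) atTop (𝓝 1) :=
    tendsto_natCast_div_add_atTop 1
  have h1 : Tendsto (fun N : ℕ => S N / N * (N / (N + 1))) atTop (𝓝 c) := by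
    simpa using hc.mul hratio
  have h2 : Tendsto (fun N : ℕ => (S (N + 1) / (N + 1 : ℕ) + 1 / W) / (N / (N + 1)))
      atTop (𝓝 (c + 1 / W)) := by
    have h := (((tendsto_add_atTop_iff_nat 1).2 hc).add_const (1 / (W : ℝ))).div hratio
      one_ne_zero
    rwa [div_one] at h
  have h3 := hdiv.eventually (h1.eventually (lt_mem_nhds (show c - ε < c by linarith)))
  have h4 := hdiv.eventually (h2.eventually
    (gt_mem_nhds (show c + 1 / W < c + 1 / W + ε by linarith)))
  filter_upwards [h3, h4, hdiv.eventually (eventually_ge_atTop 1)] with t ht3 ht4 ht5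
  set N := t / W with hN
  have hN0 : (0 : ℝ) < N := by exact_mod_cast ht5
  have hNt : W * N ≤ t := Nat.mul_div_le t W
  have htN : t ≤ W * (N + 1) := (Nat.lt_mul_div_succ t hW).le
  have hNt' : (W : ℝ) * N ≤ t := by exact_mod_cast hNt
  have htN' : (t : ℝ) ≤ W * (N + 1) := by exact_mod_cast htN
  have ht0 : (0 : ℝ) < t := lt_of_lt_of_le (by positivity) hNt'
  constructor
  · refine ht3.le.trans ?_
    have h5 : W * S N ≤ blocksIn x n K 0 t :=
      (hlow N).trans (by exact_mod_cast blocksIn_mono hn hK (Nat.zero_le _) hNt)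
    calc S N / N * (N / (N + 1)) = W * S N / (W * (N + 1)) := by field_simp
      _ ≤ W * S N / t := div_le_div_of_nonneg_left (mul_nonneg hW0.le (hS0 N)) ht0 htN'
      _ ≤ _ := div_le_div_of_nonneg_right h5 ht0.le
  · refine le_trans ?_ ht4.le
    have h5 : (blocksIn x n K 0 t : ℝ) ≤ W * S (N + 1) + (N + 1 : ℕ) :=
      le_trans (by exact_mod_cast blocksIn_mono hn hK (Nat.zero_le _) htN) (hupp (N + 1))
    have h6 : 0 ≤ W * S (N + 1) + (N + 1 : ℕ) := by
      have := mul_nonneg hW0.le (hS0 (N + 1))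
      positivity
    calc _ ≤ (W * S (N + 1) + (N + 1 : ℕ)) / t := div_le_div_of_nonneg_right h5 ht0.le
      _ ≤ (W * S (N + 1) + (N + 1 : ℕ)) / (W * N) :=
        div_le_div_of_nonneg_left h6 (by positivity) hNt'
      _ = _ := by
        push_cast
        field_simp

namespace IsMarkovErasureChannel

variable [IsProbabilityMeasure μ]

/-- The throughput exists and is almost surely constant. -/
theorem exists_isThroughput (hX : IsMarkovErasureChannel μ p X)
    (hP : IsStochastic (transitionMatrix p)) (hprim : (transitionMatrix p).IsPrimitive)
    {n K : ℕ} (hn : 1 ≤ n) (hK : 1 ≤ K) : ∃ η, IsThroughput μ l X n K η := by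
  choose c hc using fun W : ℕ => exists_tendsto_gapMean hP hprim n W (windowRate n K W)
  refine ⟨K * ⨆ V : ℕ, c (V + 1), ?_⟩
  have hae : ∀ V : ℕ, ∀ᵐ ω ∂μ, Tendsto (fun N : ℕ => (∑ k ∈ Finset.range N,
      windowRate n K (V + 1) fun i j => X i (l + (0 + (V + 1) * k) + j) ω) / (N : ℝ)) atTop
      (𝓝 (c (V + 1))) := fun V =>
    ae_tendsto_div_of_tail fun ε hε => by
      obtain ⟨C, κ, hκ, hC, h⟩ := exists_concentration (μ := μ) (Nat.succ_pos V)
        (dependsOnFirst_windowRate n K (V + 1)) (abs_windowRate_le hn hK _) (hc (V + 1)) hε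
      exact ⟨C, κ, hκ, hC, fun t => h X hX 0 t⟩
  filter_upwards [ae_all_iff.2 hae] with ω hω
  simp only [blocksCompleted_eq]
  refine (tendsto_iSup_of_eventually_between fun W hW ε hε => ?_).const_mul (K : ℝ)
  obtain ⟨V, rfl⟩ := Nat.exists_eq_add_of_le' hW
  refine eventually_blocksIn_div_between hn hK hW ?_ hε
  simpa only [Nat.zero_add, Nat.add_assoc] using hω V

end IsMarkovErasureChannel

end LawOfLargeNumbers

/-! ### Capacity, erasure bursts and reception tails. -/

section Erasures

variable {Ω : Type*} [MeasurableSpace Ω] {μ : Measure Ω}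
  {l : ℕ} {p : (Fin l → Bool) → ℝ} {X : ℕ → ℕ → Ω → Bool}

/-- The indicator of a reception of receiver `0` in slot `0`. -/
def firstReceived (x : ℕ → ℕ → Bool) : ℝ := if x 0 0 = true then 1 else 0

lemma dependsOnFirst_firstReceived : DependsOnFirst 1 1 firstReceived := by
  intro x y h
  rw [firstReceived, firstReceived, h 0 one_pos 0 one_pos]

lemma abs_firstReceived_le (x : ℕ → ℕ → Bool) : |firstReceived x| ≤ 1 := by
  unfold firstReceived
  split_ifs <;> simp

lemma sum_firstReceived (y : ℕ → Bool) (s t : ℕ) :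
    ∑ k ∈ Finset.range t, firstReceived (fun _ j => y (s + k + j)) = receptions y s (s + t) := by
  rw [receptions, Finset.sum_Ico_eq_sum_range]
  simp [firstReceived]

/-- The indicator of the event that receiver `0` receives nothing in the first `m` slots. -/
def firstErased (m : ℕ) (x : ℕ → ℕ → Bool) : ℝ := if ∀ j < m, x 0 j = false then 1 else 0

lemma dependsOnFirst_firstErased (m : ℕ) : DependsOnFirst 1 m (firstErased m) := by
  intro x y h
  have : (∀ j < m, x 0 j = false) ↔ ∀ j < m, y 0 j = false :=
    forall₂_congr fun j hj => by rw [h 0 one_pos j hj]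
  simp only [firstErased, this]

/-- The channel is in the all-erased state after `G` slots with probability at least `δ`, and from
there stays erased with the power in `pathProb_erasures`. -/
lemma le_gapMean_firstErased (hP : IsStochastic (transitionMatrix p)) (h₀ : ∀ s, 0 ≤ p s)
    (h₁ : ∀ s, p s ≤ 1) {δ : ℝ} {G : ℕ} (hδ : ∀ s u, δ ≤ (transitionMatrix p ^ G) s u) (m : ℕ)
    (s : Fin 1 → Fin l → Bool) :
    δ * (1 - p fun _ => false) ^ m ≤ gapMean p 1 m G (firstErased m) s := by
  have hnn : ∀ (s : Fin l → Bool) w, 0 ≤ gapProb p G m s w := fun s w =>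
    (hP.pow G).le_mulVec (fun u => pathProb_nonneg h₀ h₁ m u w) s
  have h1 : δ * (1 - p fun _ => false) ^ m ≤ gapProb p G m (s 0) fun _ => false := by
    rw [← pathProb_erasures]
    refine le_trans (mul_le_mul_of_nonneg_right (hδ (s 0) fun _ => false)
      (pathProb_nonneg h₀ h₁ _ _ _)) ?_
    exact Finset.single_le_sum (f := fun u => (transitionMatrix p ^ G) (s 0) u *
      pathProb p m u fun _ => false)
      (fun u _ => mul_nonneg ((hP.pow G).1 _ _) (pathProb_nonneg h₀ h₁ _ _ _))
      (Finset.mem_univ fun _ => false)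
  have h2 : firstErased m (extend fun (_ : Fin 1) (_ : Fin m) => false) *
      ∏ i : Fin 1, gapProb p G m (s i) (extend (fun (_ : Fin 1) (_ : Fin m) => false) i) =
      gapProb p G m (s 0) fun _ => false := by
    have he : extend (fun (_ : Fin 1) (_ : Fin m) => false) = fun _ _ => false := by
      funext i j
      simp [extend]
    simp [he, firstErased]
  refine h1.trans ?_
  rw [← h2]
  refine Finset.single_le_sum (f := fun w : Fin 1 → Fin m → Bool => firstErased m (extend w) *
    ∏ i : Fin 1, gapProb p G m (s i) (extend w i)) (fun w _ => ?_) (Finset.mem_univ _)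
  refine mul_nonneg ?_ (Finset.prod_nonneg fun i _ => hnn _ _)
  unfold firstErased
  split_ifs <;> simp

namespace IsMarkovErasureChannel

lemma integral_firstReceived (hX : IsMarkovErasureChannel μ p X) (i s : ℕ) :
    ∫ ω, firstReceived (fun k j => X (i + k) (s + j) ω) ∂μ = μ.real {ω | X i s ω = true} := by
  have h : (fun ω => firstReceived fun k j => X (i + k) (s + j) ω) =
      {ω | X i s ω = true}.indicator fun _ => (1 : ℝ) := by
    funext ω
    simp [firstReceived, Set.indicator_apply]
  have hm : MeasurableSet {ω | X i s ω = true} :=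
    hX.measurable i s (measurableSet_singleton true)
  rw [h, integral_indicator hm]
  simp

variable [IsProbabilityMeasure μ]

lemma integral_window (hX : IsMarkovErasureChannel μ p X) {n W : ℕ} (G : ℕ)
    {F : (ℕ → ℕ → Bool) → ℝ} (hF : DependsOnFirst n W F) :
    ∫ ω, F (fun i j => X i (l + G + j) ω) ∂μ = ∑ z : Fin n → Fin (0 + l) → Bool,
      (∏ i : Fin n, μ.real {ω | ∀ j < 0 + l, X i j ω = extend z i j}) *
        gapMean p n W G F fun i => history l 0 (extend z i) := by
  simpa using hX.integral_past_mul_window (m := 0) G (H := fun _ => 1) (fun _ _ _ => rfl) hF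

lemma sum_prod_past (hX : IsMarkovErasureChannel μ p X) (n : ℕ) :
    ∑ z : Fin n → Fin (0 + l) → Bool,
      ∏ i : Fin n, μ.real {ω | ∀ j < 0 + l, X i j ω = extend z i j} = 1 := by
  simpa using (hX.integral_past (n := n) (m := 0) (H := fun _ => 1) fun _ _ _ => rfl).symm

/-- The arbitrary initial law only enters as mixture weights of total mass `1`, and all components
have the same limit. -/
lemma tendsto_integral_window (hX : IsMarkovErasureChannel μ p X) {n W : ℕ}
    {F : (ℕ → ℕ → Bool) → ℝ} (hF : DependsOnFirst n W F) {c : ℝ}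
    (hc : ∀ s : Fin n → Fin l → Bool, Tendsto (fun G => gapMean p n W G F s) atTop (𝓝 c)) :
    Tendsto (fun G => ∫ ω, F (fun i j => X i (l + G + j) ω) ∂μ) atTop (𝓝 c) := by
  simp only [fun G => hX.integral_window G hF]
  have h := tendsto_finsetSum Finset.univ fun (z : Fin n → Fin (0 + l) → Bool) _ =>
    (hc fun i => history l 0 (extend z i)).const_mul
      (∏ i : Fin n, μ.real {ω | ∀ j < 0 + l, X i j ω = extend z i j})
  rwa [← Finset.sum_mul, hX.sum_prod_past, one_mul] at h

/-- The capacity is the limit of the conditional reception probabilities. -/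
theorem isCapacity (hX : IsMarkovErasureChannel μ p X) {γ : ℝ}
    (hγ : ∀ s : Fin 1 → Fin l → Bool,
      Tendsto (fun G => gapMean p 1 1 G firstReceived s) atTop (𝓝 γ)) : IsCapacity μ X γ := by
  intro i
  have h := (hX.comp_add_left i).tendsto_integral_window dependsOnFirst_firstReceived hγ
  rw [← tendsto_add_atTop_iff_nat l]
  simp only [hX.integral_firstReceived i, Nat.add_comm l] at h
  exact h

lemma le_measureReal_erased (hX : IsMarkovErasureChannel μ p X)
    (hP : IsStochastic (transitionMatrix p)) {δ : ℝ} {G : ℕ}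
    (hδ : ∀ s u, δ ≤ (transitionMatrix p ^ G) s u) (i m : ℕ) :
    δ * (1 - p fun _ => false) ^ m ≤ μ.real {ω | ∀ j < m, X i (l + G + j) ω = false} := by
  have h := (hX.comp_add_left i).integral_window G (dependsOnFirst_firstErased m)
  have hmeas : MeasurableSet {ω | ∀ j < m, X i (l + G + j) ω = false} := by
    have h2 : {ω | ∀ j < m, X i (l + G + j) ω = false} =
        ⋂ j ∈ Set.Iio m, {ω | X i (l + G + j) ω = false} := by
      ext ω
      simp
    rw [h2]
    exact MeasurableSet.biInter (Set.to_countable _) fun j _ =>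
      hX.measurable i _ (measurableSet_singleton false)
  have h1 : (fun ω => firstErased m fun k j => X (i + k) (l + G + j) ω) =
      {ω | ∀ j < m, X i (l + G + j) ω = false}.indicator fun _ => (1 : ℝ) := by
    funext ω
    simp [firstErased, Set.indicator_apply]
  rw [h1, integral_indicator hmeas] at h
  simp only [integral_const, MeasurableSet.univ, measureReal_restrict_apply, Set.univ_inter,
    smul_eq_mul, mul_one] at h
  have h3 := congrArg (· * (δ * (1 - p fun _ => false) ^ m))
    ((hX.comp_add_left i).sum_prod_past 1)
  simp only [one_mul, Finset.sum_mul] at h3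
  rw [h, ← h3]
  exact Finset.sum_le_sum fun z _ => mul_le_mul_of_nonneg_left
    (le_gapMean_firstErased hP hX.nonneg hX.le_one hδ m _)
    (Finset.prod_nonneg fun i _ => measureReal_nonneg)

/-- The probability that each of `n` receivers receives a packet in a window. -/
lemma measureReal_forall_exists_received_le (hX : IsMarkovErasureChannel μ p X)
    (hP : IsStochastic (transitionMatrix p)) {δ : ℝ} {G : ℕ}
    (hδ : ∀ s u, δ ≤ (transitionMatrix p ^ G) s u) (n m : ℕ) :
    μ.real {ω | ∀ i < n, ∃ j < m, X i (l + G + j) ω = true} ≤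
      Real.exp (-(n * (δ * (1 - p fun _ => false) ^ m))) := by
  set A : Set (ℕ → Bool) := {y | ∃ j < m, y (l + G + j) = true} with hA
  have hAm : MeasurableSet A := by
    have : A = ⋃ j ∈ Set.Iio m, {y : ℕ → Bool | y (l + G + j) = true} := by
      ext y
      simp [hA]
    rw [this]
    exact MeasurableSet.biUnion (Set.to_countable _) fun j _ =>
      (measurable_pi_apply (X := fun _ : ℕ => Bool) (l + G + j)) (measurableSet_singleton true)
  have h := hX.indep.measure_inter_preimage_eq_mul (Finset.range n) (sets := fun _ => A)
    fun _ _ => hAm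
  have hset : {ω | ∀ i < n, ∃ j < m, X i (l + G + j) ω = true} =
      ⋂ i ∈ Finset.range n, (fun ω j => X i j ω) ⁻¹' A := by
    ext ω
    simp [hA]
  rw [hset, measureReal_def, h, ENNReal.toReal_prod]
  have hone : ∀ i, (μ ((fun ω j => X i j ω) ⁻¹' A)).toReal ≤
      Real.exp (-(δ * (1 - p fun _ => false) ^ m)) := by
    intro i
    have h1 := hX.le_measureReal_erased hP hδ i m
    have h2 : {ω | ∀ j < m, X i (l + G + j) ω = false} = ((fun ω j => X i j ω) ⁻¹' A)ᶜ := by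
      ext ω
      simp [hA]
    rw [h2, probReal_compl_eq_one_sub (hX.measurable_channel i hAm), measureReal_def] at h1
    have h3 := Real.one_sub_le_exp_neg (δ * (1 - p fun _ => false) ^ m)
    linarith
  calc _ ≤ ∏ _i ∈ Finset.range n, Real.exp (-(δ * (1 - p fun _ => false) ^ m)) :=
        Finset.prod_le_prod (fun _ _ => ENNReal.toReal_nonneg) fun i _ => hone i
    _ = _ := by
        rw [Finset.prod_const, Finset.card_range, ← Real.exp_nat_mul]
        ring_nf

/-- The number of receptions of a receiver concentrates around its mean. -/
theorem exists_receptions_tail {γ : ℝ}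
    (hγ : ∀ s : Fin 1 → Fin l → Bool,
      Tendsto (fun G => gapMean p 1 1 G firstReceived s) atTop (𝓝 γ)) {ε : ℝ} (hε : 0 < ε) :
    ∃ C κ : ℝ, 0 < κ ∧ 0 ≤ C ∧ ∀ X : ℕ → ℕ → Ω → Bool, IsMarkovErasureChannel μ p X →
      ∀ i a t : ℕ, μ.real {ω | ε * t ≤
        |(receptions (fun j => X i (l + j) ω) a (a + t) : ℝ) - γ * t|} ≤
          C * Real.exp (-κ * t) := by
  obtain ⟨C, κ, hκ, hC, h⟩ := exists_concentration (μ := μ) le_rfl dependsOnFirst_firstReceived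
    abs_firstReceived_le hγ hε
  refine ⟨C, κ, hκ, hC, fun X hX i a t => ?_⟩
  have h1 := h _ (hX.comp_add_left i) a t
  have h2 : ∀ ω, ∑ k ∈ Finset.range t, firstReceived
      (fun i' j => X (i + i') (l + (a + 1 * k) + j) ω) =
      receptions (fun j => X i (l + j) ω) a (a + t) := fun ω => by
    rw [← sum_firstReceived]
    simp [firstReceived]
  simpa only [h2] using h1

end IsMarkovErasureChannel

end Erasures

/-! ### Upper and lower bounds on the throughput. -/

section Bounds

variable {Ω : Type*} [MeasurableSpace Ω] {μ : Measure Ω}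
  {l : ℕ} {p : (Fin l → Bool) → ℝ} {X : ℕ → ℕ → Ω → Bool}

namespace IsMarkovErasureChannel

lemma measurable_blocksIn (hX : IsMarkovErasureChannel μ p X) (n K s t : ℕ) :
    Measurable fun ω => (blocksIn (fun i j => X i (l + j) ω) n K s t : ℝ) :=
  hX.measurable_of_dependsOnFirst (n := n) (M := t)
    (H := fun x => (blocksIn x n K s t : ℝ))
    (fun _ _ h => congrArg Nat.cast (blocksIn_congr fun i hi j _ hj => h i hi j hj)) l

lemma measurable_receptions (hX : IsMarkovErasureChannel μ p X) (i s t : ℕ) :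
    Measurable fun ω => receptions (fun j => X i (l + j) ω) s t :=
  hX.measurable_of_dependsOnFirst (n := i + 1) (M := t) (H := fun x => receptions (x i) s t)
    (fun _ _ h => receptions_congr fun j _ hj => h i (Nat.lt_succ_self i) j hj) l

variable [IsProbabilityMeasure μ]

lemma integrable_blocksIn (hX : IsMarkovErasureChannel μ p X) {n K s t : ℕ} (hn : 1 ≤ n)
    (hK : 1 ≤ K) (hst : s ≤ t) :
    Integrable (fun ω => (blocksIn (fun i j => X i (l + j) ω) n K s t : ℝ)) μ := by
  refine Integrable.of_bound (hX.measurable_blocksIn n K s t).aestronglyMeasurable (t - s : ℕ)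
    (Eventually.of_forall fun ω => ?_)
  rw [Real.norm_of_nonneg (by positivity)]
  exact_mod_cast blocksIn_le hn hK hst

/-- The throughput is the limit of the mean number of packets per slot. -/
lemma tendsto_integral_blocksIn (hX : IsMarkovErasureChannel μ p X) {n K : ℕ} (hn : 1 ≤ n)
    (hK : 1 ≤ K) {η : ℝ} (hη : IsThroughput μ l X n K η) :
    Tendsto (fun t : ℕ => K * (∫ ω, (blocksIn (fun i j => X i (l + j) ω) n K 0 t : ℝ) ∂μ) / t)
      atTop (𝓝 η) := by
  have h : Tendsto (fun t : ℕ => ∫ ω, (K : ℝ) *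
      ((blocksIn (fun i j => X i (l + j) ω) n K 0 t : ℝ) / t) ∂μ) atTop (𝓝 (∫ _, η ∂μ)) := by
    -- The constant `1` dominates because every block occupies at least `K` slots.
    refine tendsto_integral_of_dominated_convergence (fun _ => 1) (fun t => ?_)
      (integrable_const 1) (fun t => Eventually.of_forall fun ω => ?_) ?_
    · exact (((hX.measurable_blocksIn n K 0 t).div_const _).const_mul _).aestronglyMeasurable
    · rw [Real.norm_of_nonneg (by positivity), ← mul_div_assoc]
      refine div_le_one_of_le₀ ?_ (by positivity)
      have h1 := (blocksIn_mul_le_receptions (x := fun i j => X i (l + j) ω) hn hK (i := 0) hn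
        (Nat.zero_le t)).trans (receptions_le _ _ _)
      rw [Nat.sub_zero, mul_comm] at h1
      exact_mod_cast h1
    · filter_upwards [hη] with ω hω
      simpa only [blocksCompleted_eq] using hω
  simp only [integral_const_mul, integral_div, integral_const, probReal_univ, one_smul,
    ← mul_div_assoc] at h
  exact h

lemma throughput_nonneg (hX : IsMarkovErasureChannel μ p X) {n K : ℕ} (hn : 1 ≤ n)
    (hK : 1 ≤ K) {η : ℝ} (hη : IsThroughput μ l X n K η) : 0 ≤ η :=
  ge_of_tendsto' (hX.tendsto_integral_blocksIn hn hK hη) fun t =>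
    div_nonneg (mul_nonneg (by positivity) (integral_nonneg fun ω => Nat.cast_nonneg _))
      (by positivity)

/-- The throughput does not exceed the capacity. -/
theorem throughput_le_capacity (hX : IsMarkovErasureChannel μ p X) {n K : ℕ} (hn : 1 ≤ n)
    (hK : 1 ≤ K) {η γ : ℝ} (hη : IsThroughput μ l X n K η) (hγ : IsCapacity μ X γ) : η ≤ γ := by
  have h1 : Tendsto (fun j => μ.real {ω | X 0 (l + j) ω = true}) atTop (𝓝 γ) := by
    simpa only [Nat.add_comm l] using (tendsto_add_atTop_iff_nat l).2 (hγ 0)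
  refine le_of_tendsto_of_tendsto' (hX.tendsto_integral_blocksIn hn hK hη) h1.cesaro fun t => ?_
  rw [inv_mul_eq_div]
  refine div_le_div_of_nonneg_right ?_ (by positivity)
  have hint : ∀ j, Integrable (fun ω => firstReceived fun k j' => X (0 + k) (l + j + j') ω) μ :=
    fun j => Integrable.of_bound ((hX.comp_add_left 0).measurable_of_dependsOnFirst
      dependsOnFirst_firstReceived (l + j)).aestronglyMeasurable 1
      (Eventually.of_forall fun ω => abs_firstReceived_le _)
  simp only [← hX.integral_firstReceived 0]
  rw [← integral_const_mul, ← integral_finsetSum _ fun j _ => hint j]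
  refine integral_mono ((hX.integrable_blocksIn hn hK (Nat.zero_le t)).const_mul _)
    (integrable_finsetSum _ fun j _ => hint j) fun ω => ?_
  have h2 := blocksIn_mul_le_receptions (x := fun i j => X i (l + j) ω) hn hK (i := 0) hn
    (Nat.zero_le t)
  have h3 := sum_firstReceived (fun j => X 0 (l + j) ω) 0 t
  simp only [firstReceived, Nat.zero_add] at h3 ⊢
  simp only [Nat.add_zero] at h3 ⊢
  rw [h3, mul_comm]
  exact_mod_cast h2

/-- An upper bound on the throughput: long erasure bursts of some receiver interrupt the
transmission. -/
theorem throughput_le (hX : IsMarkovErasureChannel μ p X)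
    (hP : IsStochastic (transitionMatrix p)) {δ : ℝ} {N₀ : ℕ}
    (hδ : ∀ G ≥ N₀, ∀ s u, δ ≤ (transitionMatrix p ^ G) s u) {n K : ℕ} (hn : 1 ≤ n)
    (hK : 1 ≤ K) {η : ℝ} (hη : IsThroughput μ l X n K η) {m : ℕ} (hm : 1 ≤ m) (hm₀ : N₀ ≤ m) :
    η ≤ K / m + Real.exp (-(n * (δ * (1 - p fun _ => false) ^ m))) := by
  set b := Real.exp (-(n * (δ * (1 - p fun _ => false) ^ m))) with hb
  have hm0 : (0 : ℝ) < m := by exact_mod_cast hm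
  -- A silent receiver excludes any whole block from the window; otherwise the blocks inside carry
  -- at most `m` packets.
  have hwin : ∀ k, K * ∫ ω, (blocksIn (fun i j => X i (l + j) ω) n K (m * k) (m * k + m) : ℝ) ∂μ ≤
      m * μ.real {ω | ∀ i < n, ∃ j < m, X i (l + m * k + j) ω = true} := by
    intro k
    have hmeas : MeasurableSet {ω | ∀ i < n, ∃ j < m, X i (l + m * k + j) ω = true} := by
      refine measurableSet_setOfPred.2 (hX.measurable_of_dependsOnFirst (n := n) (M := m)
        (H := fun x => ∀ i < n, ∃ j < m, x i j = true) (fun x y h => ?_) (l + m * k))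
      refine propext (forall₂_congr fun i hi => exists_congr fun j => and_congr_right fun hj => ?_)
      rw [h i hi j hj]
    have h1 := integral_mono
      ((hX.integrable_blocksIn hn hK (Nat.le_add_right (m * k) m)).const_mul (K : ℝ))
      ((integrable_const (m : ℝ)).indicator hmeas) (fun ω => ?_)
    · rw [integral_const_mul, integral_indicator hmeas, setIntegral_const, smul_eq_mul,
        mul_comm (μ.real _)] at h1
      exact h1
    · rw [Set.indicator_apply]
      split_ifs with hω
      · have h2 := (blocksIn_mul_le_receptions (x := fun i j => X i (l + j) ω) hn hK (i := 0) hn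
          (Nat.le_add_right (m * k) m)).trans (receptions_le _ _ _)
        rw [Nat.add_sub_cancel_left, mul_comm] at h2
        exact_mod_cast h2
      · simp only [Set.mem_ofPred_eq, not_forall, not_exists, not_and] at hω
        obtain ⟨i, hi, hω⟩ := hω
        have h2 := blocksIn_mul_le_receptions (x := fun i j => X i (l + j) ω) hn hK hi
          (Nat.le_add_right (m * k) m)
        have h3 : receptions (fun j => X i (l + j) ω) (m * k) (m * k + m) = 0 := by
          refine Finset.sum_eq_zero fun j hj => if_neg ?_
          rw [Finset.mem_Ico] at hj
          obtain ⟨d, rfl⟩ := Nat.exists_eq_add_of_le hj.1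
          simp only [← Nat.add_assoc]
          exact hω d (by omega)
        rw [h3, mul_comm] at h2
        exact_mod_cast h2
  have hsum : ∀ N : ℕ, K * ∫ ω, (blocksIn (fun i j => X i (l + j) ω) n K 0 (m * N) : ℝ) ∂μ ≤
      K * N + m * (N * b + 1) := by
    intro N
    have h1 : ∫ ω, (blocksIn (fun i j => X i (l + j) ω) n K 0 (m * N) : ℝ) ∂μ ≤
        ∑ k ∈ Finset.range N, (∫ ω, (blocksIn (fun i j => X i (l + j) ω) n K (m * k) (m * k + m) :
          ℝ) ∂μ + 1) := by
      have hint := fun k => hX.integrable_blocksIn (n := n) (K := K) hn hK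
        (Nat.le_add_right (m * k) m)
      have h2 := integral_mono (hX.integrable_blocksIn hn hK (Nat.zero_le (m * N)))
        (integrable_finsetSum (Finset.range N) fun k _ => (hint k).add (integrable_const (1 : ℝ)))
        (fun ω => ?_)
      · rw [integral_finsetSum _ fun k _ => (hint k).add (integrable_const (1 : ℝ))] at h2
        refine h2.trans_eq (Finset.sum_congr rfl fun k _ => ?_)
        simp only [Pi.add_apply]
        rw [integral_add (hint k) (integrable_const _)]
        simp
      · have h3 := blocksIn_le_sum (x := fun i j => X i (l + j) ω) hn hK 0 m N
        simp only [Nat.zero_add] at h3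
        simp only [Pi.add_apply]
        exact_mod_cast h3
    have hstep : ∀ k ∈ Finset.range N, K * (∫ ω, (blocksIn (fun i j => X i (l + j) ω) n K (m * k)
        (m * k + m) : ℝ) ∂μ + 1) ≤ K + m * (b + if k = 0 then 1 else 0) := by
      intro k _
      have h2 := hwin k
      -- Window `0` follows the initial state without a gap, so the burst bound need not apply
      -- there; it is charged probability `1`, which disappears in the average.
      have h3 : μ.real {ω | ∀ i < n, ∃ j < m, X i (l + m * k + j) ω = true} ≤
          b + if k = 0 then 1 else 0 := by
        split_ifs with hk
        · have : 0 ≤ b := (Real.exp_pos _).le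
          exact measureReal_le_one.trans (by linarith)
        · rw [add_zero]
          exact hX.measureReal_forall_exists_received_le hP
            (hδ _ (hm₀.trans (Nat.le_mul_of_pos_right m (Nat.pos_of_ne_zero hk)))) n m
      have h4 := mul_le_mul_of_nonneg_left h3 hm0.le
      linarith
    refine (mul_le_mul_of_nonneg_left h1 (Nat.cast_nonneg K)).trans ?_
    rw [Finset.mul_sum]
    refine (Finset.sum_le_sum hstep).trans ?_
    rw [Finset.sum_add_distrib, ← Finset.mul_sum, Finset.sum_add_distrib]
    simp only [Finset.sum_const, Finset.card_range, nsmul_eq_mul]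
    have h5 : ∑ k ∈ Finset.range N, (if k = 0 then (1 : ℝ) else 0) ≤ 1 := by
      rw [Finset.sum_ite_eq']
      split_ifs <;> simp
    have h6 := mul_le_mul_of_nonneg_left h5 hm0.le
    linarith
  have hlim := (hX.tendsto_integral_blocksIn hn hK hη).comp (tendsto_id.const_mul_atTop' hm)
  have hlim' : Tendsto (fun N : ℕ => (K / m + b : ℝ) + 1 / N) atTop (𝓝 (K / m + b)) := by
    simpa using (tendsto_const_nhds (x := (K / m + b : ℝ))).add tendsto_one_div_atTop_nhds_zero_nat
  refine le_of_tendsto_of_tendsto hlim hlim' ?_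
  filter_upwards [eventually_gt_atTop 0] with N hN
  have hN0 : (0 : ℝ) < N := by exact_mod_cast hN
  simp only [Function.comp_apply, id_eq]
  push_cast
  rw [div_le_iff₀ (by positivity)]
  refine (hsum N).trans_eq ?_
  field_simp
  ring

/-- A lower bound on the throughput in terms of the probability that a receiver does not receive
`K` packets in a window. -/
theorem le_throughput (hX : IsMarkovErasureChannel μ p X) {n K : ℕ} (hn : 1 ≤ n)
    (hK : 1 ≤ K) {η : ℝ} (hη : IsThroughput μ l X n K η) {W : ℕ} (hW : 1 ≤ W) {b : ℝ}
    (hb : ∀ i a, μ.real {ω | receptions (fun j => X i (l + j) ω) a (a + W) < K} ≤ b) :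
    K / W * (1 - n * b) ≤ η := by
  have hW0 : (0 : ℝ) < W := by exact_mod_cast hW
  -- Union bound: a window contains a whole block unless some receiver gets fewer than `K` packets.
  have hwin : ∀ k, 1 - n * b ≤
      ∫ ω, (blocksIn (fun i j => X i (l + j) ω) n K (W * k) (W * k + W) : ℝ) ∂μ := by
    intro k
    set A : ℕ → Set Ω := fun i =>
      {ω | receptions (fun j => X i (l + j) ω) (W * k) (W * k + W) < K} with hA
    have hAm : ∀ i, MeasurableSet (A i) := fun i =>
      measurableSet_lt (hX.measurable_receptions i _ _) measurable_const
    have hAi : ∀ i, Integrable ((A i).indicator fun _ => (1 : ℝ)) μ := fun i =>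
      (integrable_const 1).indicator (hAm i)
    have h1 := integral_mono ((integrable_const (1 : ℝ)).sub
      (integrable_finsetSum (Finset.range n) fun i _ => hAi i))
      (hX.integrable_blocksIn hn hK (Nat.le_add_right (W * k) W)) (fun ω => ?_)
    · refine le_trans ?_ h1
      simp only [Pi.sub_apply]
      rw [integral_sub (integrable_const _) (integrable_finsetSum _ fun i _ => hAi i),
        integral_finsetSum _ fun i _ => hAi i]
      simp only [integral_indicator (hAm _), setIntegral_const, smul_eq_mul, mul_one]
      rw [integral_const, probReal_univ, one_smul]
      have h2 : ∑ i ∈ Finset.range n, μ.real (A i) ≤ n * b :=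
        (Finset.sum_le_sum fun i _ => hb i (W * k)).trans_eq (by simp)
      linarith
    · simp only [Pi.sub_apply]
      by_cases hω : ∃ i < n, ω ∈ A i
      · obtain ⟨i, hi, hω⟩ := hω
        have h2 : (A i).indicator (fun _ => (1 : ℝ)) ω ≤
            ∑ i ∈ Finset.range n, (A i).indicator (fun _ => (1 : ℝ)) ω :=
          Finset.single_le_sum (f := fun i => (A i).indicator (fun _ => (1 : ℝ)) ω)
            (fun i _ => Set.indicator_nonneg (fun _ _ => zero_le_one) _) (Finset.mem_range.2 hi)
        rw [Set.indicator_of_mem hω] at h2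
        have h3 : (0 : ℝ) ≤
          (blocksIn (fun i j => X i (l + j) ω) n K (W * k) (W * k + W) : ℝ) := Nat.cast_nonneg _
        linarith
      · push Not at hω
        have h2 := one_le_blocksIn (x := fun i j => X i (l + j) ω) hn hK
          (Nat.le_add_right (W * k) W) fun i hi => not_lt.1 (hω i hi)
        have h3 : 0 ≤ ∑ i ∈ Finset.range n, (A i).indicator (fun _ => (1 : ℝ)) ω :=
          Finset.sum_nonneg fun i _ => Set.indicator_nonneg (fun _ _ => zero_le_one) _
        have h4 : (1 : ℝ) ≤
          (blocksIn (fun i j => X i (l + j) ω) n K (W * k) (W * k + W) : ℝ) := by exact_mod_cast h2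
        linarith
  have hlim := (hX.tendsto_integral_blocksIn hn hK hη).comp (tendsto_id.const_mul_atTop' hW)
  refine ge_of_tendsto hlim ?_
  filter_upwards [eventually_gt_atTop 0] with N hN
  have hN0 : (0 : ℝ) < N := by exact_mod_cast hN
  simp only [Function.comp_apply, id_eq]
  push_cast
  rw [le_div_iff₀ (by positivity)]
  have hint := fun k => hX.integrable_blocksIn (n := n) (K := K) hn hK
    (Nat.le_add_right (W * k) W)
  have h1 := integral_mono (integrable_finsetSum (Finset.range N) fun k _ => hint k)
    (hX.integrable_blocksIn hn hK (Nat.zero_le (W * N))) (fun ω => by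
      have h3 := sum_blocksIn_le (x := fun i j => X i (l + j) ω) hn hK 0 W N
      simp only [Nat.zero_add] at h3
      exact_mod_cast h3)
  rw [integral_finsetSum _ fun k _ => hint k] at h1
  have h2 : N * (1 - n * b) ≤ ∑ k ∈ Finset.range N,
      ∫ ω, (blocksIn (fun i j => X i (l + j) ω) n K (W * k) (W * k + W) : ℝ) ∂μ := by
    refine le_trans (by simp [mul_sub]) (Finset.sum_le_sum fun k _ => hwin k)
  calc K / W * (1 - n * b) * (W * N) = K * (N * (1 - n * b)) := by field_simp
    _ ≤ _ := mul_le_mul_of_nonneg_left (h2.trans h1) (Nat.cast_nonneg K)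

end IsMarkovErasureChannel

end Bounds

/-! ### Choice of window lengths as `n` grows. -/

section Asymptotics

lemma tendsto_log_natCast_atTop : Tendsto (fun n : ℕ => Real.log n) atTop atTop :=
  Real.tendsto_log_atTop.comp tendsto_natCast_atTop_atTop

lemma tendsto_zero_of_burst_bound {q δ : ℝ} (hq : 0 < q) (hq1 : q ≤ 1) (hδ : 0 < δ) (N₀ : ℕ)
    {K : ℕ → ℕ} (hK : Tendsto (fun n : ℕ => (K n : ℝ) / Real.log n) atTop (𝓝 0)) {η : ℕ → ℝ}
    (h0 : ∀ n, 1 ≤ n → 0 ≤ η n)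
    (h : ∀ n, 1 ≤ n → ∀ m : ℕ, 1 ≤ m → N₀ ≤ m →
      η n ≤ K n / m + Real.exp (-(n * (δ * q ^ m)))) :
    Tendsto η atTop (𝓝 0) := by
  have hlogq : Real.log q ≤ 0 := Real.log_nonpos hq.le hq1
  -- With `m = ⌊log n / A⌋` this gives `q ^ m ≥ n ^ (-1/2)`; the summand `1` keeps `A` positive when
  -- `q = 1`.
  set A := 2 * (1 - Real.log q) with hA
  have hA0 : 0 < A := by linarith
  have hlog := tendsto_log_natCast_atTop
  have hlim : Tendsto (fun n : ℕ => 2 * A * ((K n : ℝ) / Real.log n) +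
      Real.exp (-(δ * Real.exp (Real.log n / 2)))) atTop (𝓝 0) := by
    have h1 : Tendsto (fun n : ℕ => Real.exp (-(δ * Real.exp (Real.log n / 2)))) atTop (𝓝 0) :=
      Real.tendsto_exp_neg_atTop_nhds_zero.comp ((Real.tendsto_exp_atTop.comp
        (hlog.atTop_div_const two_pos)).const_mul_atTop hδ)
    simpa using (hK.const_mul (2 * A)).add h1
  refine tendsto_of_tendsto_of_tendsto_of_le_of_le' tendsto_const_nhds hlim ?_ ?_
  · filter_upwards [eventually_ge_atTop 1] with n hn using h0 n hn
  -- The threshold ensures both `m ≥ N₀ + 1` and that the floor loses at most half of `log n / A`.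
  filter_upwards [eventually_ge_atTop 1, hlog.eventually_ge_atTop (2 * A * (N₀ + 1))] with n hn hL
  set L := Real.log n with hLdef
  have hL0 : 0 < L := lt_of_lt_of_le (by positivity) hL
  have hN₀ : (0 : ℝ) ≤ N₀ := Nat.cast_nonneg _
  have hL2 : 2 * (N₀ + 1) ≤ L / A := by
    rw [le_div_iff₀ hA0]
    linarith
  have hm1 : (⌊L / A⌋₊ : ℝ) ≤ L / A := Nat.floor_le (by positivity)
  have hm2 : L / A < ⌊L / A⌋₊ + 1 := Nat.lt_floor_add_one _
  set m := ⌊L / A⌋₊ with hm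
  have hm3 : (N₀ : ℝ) + 1 ≤ m := by linarith
  have hm4 : N₀ + 1 ≤ m := by exact_mod_cast hm3
  have hm5 : L / (2 * A) ≤ m := by
    rw [show L / (2 * A) = L / A / 2 by field_simp]
    linarith
  refine (h n hn m (by omega) (by omega)).trans (add_le_add ?_ (Real.exp_le_exp.2 ?_))
  · calc (K n : ℝ) / m ≤ K n / (L / (2 * A)) :=
          div_le_div_of_nonneg_left (Nat.cast_nonneg _) (by positivity) hm5
      _ = 2 * A * (K n / L) := by field_simp
  · refine neg_le_neg ?_
    have hn0 : (0 : ℝ) < n := by exact_mod_cast hn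
    have hqm : Real.exp (-(L / 2)) ≤ q ^ m := by
      rw [← Real.exp_log hq, ← Real.exp_nat_mul, Real.exp_le_exp]
      have h1 : (m : ℝ) * -Real.log q ≤ L / A * -Real.log q :=
        mul_le_mul_of_nonneg_right hm1 (by linarith)
      have h2 : L / A * -Real.log q ≤ L / 2 := by
        rw [div_mul_eq_mul_div, div_le_div_iff₀ hA0 two_pos]
        nlinarith
      linarith
    calc δ * Real.exp (L / 2) = n * (δ * Real.exp (-(L / 2))) := by
          have h3 : Real.exp (L / 2) = n * Real.exp (-(L / 2)) := by
            have hnL : Real.exp L = n := Real.exp_log hn0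
            rw [← hnL, ← Real.exp_add]
            congr 1
            ring
          rw [h3]
          ring
      _ ≤ n * (δ * q ^ m) := by gcongr

/-- Eventually `κ * K n ≥ 2 * log n`, so `n * exp (-κ * K n) ≤ 1 / n`. This is where the union bound
over receivers needs `K` to dominate `log n`. -/
lemma tendsto_mul_exp_neg_zero {K : ℕ → ℕ}
    (hK : Tendsto (fun n : ℕ => (K n : ℝ) / Real.log n) atTop atTop) (C : ℝ) {κ : ℝ}
    (hκ : 0 < κ) : Tendsto (fun n : ℕ => n * (C * Real.exp (-κ * K n))) atTop (𝓝 0) := by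
  have hlog := tendsto_log_natCast_atTop
  have h : Tendsto (fun n : ℕ => n * Real.exp (-κ * K n)) atTop (𝓝 0) := by
    refine tendsto_of_tendsto_of_tendsto_of_le_of_le' tendsto_const_nhds
      (Real.tendsto_exp_neg_atTop_nhds_zero.comp hlog) ?_ ?_
    · exact Eventually.of_forall fun n => by positivity
    · filter_upwards [hlog.eventually_gt_atTop 0, hK.eventually_ge_atTop (2 / κ),
        eventually_gt_atTop 0] with n hL hn hn0
      have hn0' : (0 : ℝ) < n := by exact_mod_cast hn0
      rw [div_le_div_iff₀ hκ hL] at hn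
      simp only [Function.comp_apply]
      nth_rewrite 1 [← Real.exp_log hn0']
      rw [← Real.exp_add, Real.exp_le_exp]
      linarith
  have h2 := h.const_mul C
  rw [mul_zero] at h2
  refine h2.congr fun n => ?_
  ring

lemma tendsto_atTop_of_div_log {K : ℕ → ℕ}
    (hK : Tendsto (fun n : ℕ => (K n : ℝ) / Real.log n) atTop atTop) :
    Tendsto (fun n : ℕ => (K n : ℝ)) atTop atTop := by
  have hlog := tendsto_log_natCast_atTop
  refine (hK.atTop_mul_atTop₀ hlog).congr' ?_
  filter_upwards [hlog.eventually_gt_atTop 0] with n hn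
  field_simp

variable {Ω : Type*} [MeasurableSpace Ω] {μ : Measure Ω} [IsProbabilityMeasure μ]
  {l : ℕ} {p : (Fin l → Bool) → ℝ} {X : ℕ → ℕ → Ω → Bool}

lemma IsCapacity.le_one {γ : ℝ} (hγ : IsCapacity μ X γ) : γ ≤ 1 :=
  le_of_tendsto' (hγ 0) fun _ => measureReal_le_one

/-- Blocks of size `ω(log n)` almost achieve every rate below capacity. -/
lemma IsMarkovErasureChannel.eventually_lt_throughput (hX : IsMarkovErasureChannel μ p X) {γ : ℝ}
    (hγ : ∀ s : Fin 1 → Fin l → Bool,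
      Tendsto (fun G => gapMean p 1 1 G firstReceived s) atTop (𝓝 γ))
    {K : ℕ → ℕ} (hK1 : ∀ n, 1 ≤ K n)
    (hK : Tendsto (fun n : ℕ => (K n : ℝ) / Real.log n) atTop atTop) {η : ℕ → ℝ}
    (hη : ∀ n, 1 ≤ n → IsThroughput μ l X n (K n) (η n)) {a : ℝ} (ha : a < γ) :
    ∀ᶠ n in atTop, a < η n := by
  rcases lt_or_ge a 0 with ha0 | ha0
  · filter_upwards [eventually_ge_atTop 1] with n hn
    exact ha0.trans_le (hX.throughput_nonneg hn (hK1 n) (hη n hn))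
  obtain ⟨g, hag, hgγ⟩ := exists_between ha
  have hg : 0 < g := ha0.trans_lt hag
  have hg1 : g ≤ 1 := hgγ.le.trans (hX.isCapacity hγ).le_one
  obtain ⟨C, κ, hκ, hC, htail⟩ := IsMarkovErasureChannel.exists_receptions_tail (μ := μ) hγ
    (sub_pos.2 hgγ)
  have hb := tendsto_mul_exp_neg_zero hK C hκ
  have hlim : Tendsto (fun n : ℕ => (1 / g + 1 / (K n : ℝ))⁻¹ *
      (1 - n * (C * Real.exp (-κ * K n)))) atTop (𝓝 g) := by
    have h1 : Tendsto (fun n : ℕ => (1 / g + 1 / (K n : ℝ))⁻¹) atTop (𝓝 g) := by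
      have h2 := ((tendsto_const_nhds (x := 1 / g)).add
        ((tendsto_atTop_of_div_log hK).const_div_atTop 1)).inv₀ (by positivity)
      simpa using h2
    simpa using h1.mul (hb.const_sub 1)
  filter_upwards [hlim.eventually (lt_mem_nhds hag), hb.eventually (gt_mem_nhds one_pos),
    eventually_ge_atTop 1] with n h1 h2 hn
  refine h1.trans_le ?_
  have hK0 : (0 : ℝ) < K n := by exact_mod_cast hK1 n
  -- The shortest window in which rate `g` yields `K n` packets. Missing `K n` in it is a deviation
  -- by `(γ - g) * W`, and `g ≤ 1` gives `W ≥ K n`, so the tail is at most `C * exp (-κ * K n)`.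
  set W := ⌈(K n : ℝ) / g⌉₊ with hW
  have hW1 : (K n : ℝ) / g ≤ W := Nat.le_ceil _
  have hW2 : (W : ℝ) < K n / g + 1 := Nat.ceil_lt_add_one (by positivity)
  have hW3 : 1 ≤ W := Nat.one_le_ceil_iff.2 (by positivity)
  have hW0 : (0 : ℝ) < W := by exact_mod_cast hW3
  have hKW : (K n : ℝ) ≤ W := le_trans (by
    rw [le_div_iff₀ hg]
    exact mul_le_of_le_one_right hK0.le hg1) hW1
  have hbad : ∀ i a, μ.real {ω | receptions (fun j => X i (l + j) ω) a (a + W) < K n} ≤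
      C * Real.exp (-κ * K n) := by
    intro i a
    refine (measureReal_mono fun ω hω => ?_).trans ((htail X hX i a W).trans ?_)
    · have h3 : (receptions (fun j => X i (l + j) ω) a (a + W) : ℝ) < K n := by
        exact_mod_cast hω
      have h4 : (K n : ℝ) ≤ W * g := (div_le_iff₀ hg).1 hW1
      rw [Set.mem_ofPred_eq]
      refine le_trans ?_ (neg_le_abs _)
      linarith
    · have h5 : κ * K n ≤ κ * W := mul_le_mul_of_nonneg_left hKW hκ.le
      exact mul_le_mul_of_nonneg_left (Real.exp_le_exp.2 (by linarith)) hC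
  refine le_trans ?_ (hX.le_throughput hn (hK1 n) (hη n hn) hW3 hbad)
  refine mul_le_mul_of_nonneg_right ?_ (by linarith)
  rw [inv_le_comm₀ (by positivity) (by positivity), inv_div]
  calc (W : ℝ) / K n ≤ (K n / g + 1) / K n := div_le_div_of_nonneg_right hW2.le hK0.le
    _ = 1 / g + 1 / K n := by field_simp

end Asymptotics

end BroadcastErasure

end
-- Assembly of the two regimes.
theorem corollary1 {Ω : Type*} [MeasurableSpace Ω] (μ : Measure Ω) [IsProbabilityMeasure μ]
    (l : ℕ) (p : (Fin l → Bool) → ℝ) (X : ℕ → ℕ → Ω → Bool)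
    (hX : BroadcastErasure.IsMarkovErasureChannel μ p X)
    (hirr : (BroadcastErasure.transitionMatrix p).IsIrreducible)
    (haper : BroadcastErasure.IsAperiodic (BroadcastErasure.transitionMatrix p)) :
    ∃ (γ : ℝ) (η : ℕ → ℕ → ℝ),
      BroadcastErasure.IsCapacity μ X γ ∧
      (∀ n K : ℕ, 1 ≤ n → 1 ≤ K → BroadcastErasure.IsThroughput μ l X n K (η n K)) ∧
      ∀ K : ℕ → ℕ, (∀ n, 1 ≤ K n) →
        (p (fun _ => false) < 1 →
          Tendsto (fun n : ℕ => (K n : ℝ) / Real.log (n : ℝ)) atTop (𝓝 0) →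
          Tendsto (fun n : ℕ => η n (K n)) atTop (𝓝 0)) ∧
        (Tendsto (fun n : ℕ => (K n : ℝ) / Real.log (n : ℝ)) atTop atTop →
          Tendsto (fun n : ℕ => η n (K n)) atTop (𝓝 γ)) := by
  have hP := BroadcastErasure.isStochastic_transitionMatrix hX.nonneg hX.le_one
  have hprim := BroadcastErasure.isPrimitive_of_isAperiodic hirr haper
  obtain ⟨γ, hγ⟩ := BroadcastErasure.exists_tendsto_gapMean hP hprim 1 1
    BroadcastErasure.firstReceived
  have hcap := hX.isCapacity hγ
  have hex : ∀ n K : ℕ, ∃ η, 1 ≤ n → 1 ≤ K → BroadcastErasure.IsThroughput μ l X n K η := by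
    intro n K
    by_cases h : 1 ≤ n ∧ 1 ≤ K
    · obtain ⟨η, hη⟩ := hX.exists_isThroughput hP hprim h.1 h.2
      exact ⟨η, fun _ _ => hη⟩
    · exact ⟨0, fun hn hK => absurd ⟨hn, hK⟩ h⟩
  choose η hη using hex
  refine ⟨γ, η, hcap, hη, fun K hK1 => ⟨fun hp hK => ?_, fun hK => ?_⟩⟩
  · obtain ⟨δ, hδ, N₀, _, hle⟩ := hP.exists_le_pow hprim
    have hp0 := hX.nonneg fun _ => false
    exact BroadcastErasure.tendsto_zero_of_burst_bound (sub_pos.2 hp) (by linarith) hδ N₀ hK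
      (fun n hn => hX.throughput_nonneg hn (hK1 n) (hη n _ hn (hK1 n)))
      fun n hn m hm hm₀ => hX.throughput_le hP hle hn (hK1 n) (hη n _ hn (hK1 n)) hm hm₀
  · refine tendsto_order.2 ⟨fun a ha => ?_, fun a ha => ?_⟩
    · exact hX.eventually_lt_throughput hγ hK1 hK (fun n hn => hη n _ hn (hK1 n)) ha
    · filter_upwards [eventually_ge_atTop 1] with n hn
      exact (hX.throughput_le_capacity hn (hK1 n) (hη n _ hn (hK1 n)) hcap).trans_lt ha
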